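/- Let $X$ be a proper geodesic metric space that is hyperbolic in the sense of Gromov (for instance a complete simply connected Riemannian manifold of sectional curvature $K\le -1$), and let $\Gamma$ be a torsion free group acting on $X$ by isometries, properly discontinuously and co-compactly. Write $\partial\Gamma=\partial X$ for the boundary at infinity (geodesic rays up to bounded distance), with the topology and the notion of Hölder map given by its Gromov distances, i.e. by $\exp(-(x|y)_o)$ where $(x|y)_o$ is the Gromov product based at a point $o\in X$. Let $d\ge 2$ and let $\rho:\Gamma\to \mathrm{PGL}(d,\mathbb R)$ be a representation (in particular $\rho$ may take values in $\mathrm{SL}(d,\mathbb R)$ or $\mathrm{PSL}(d,\mathbb R)$). A *convex pair* for $\rho$ is a Hölder continuous $\rho$-equivariant map $$(\xi,\eta):\partial\Gamma\to\mathbb P(\mathbb R^d)\times\mathrm{Gr}_{d-1}(\mathbb R^d)$$ such that $\mathbb R^d=\xi(x)\oplus\eta(y)$ whenever $x\ne y$; $\rho$ is *strictly convex* if it is irreducible and admits a convex pair. An element $g$ is *proximal* if (a lift of) $g$ has a unique complex eigenvalue of maximal modulus and the generalized eigenspace of this eigenvalue is one dimensional; the eigenvalue is then real and its eigenline in $\mathbb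 R^d$ is the *attracting line* of $g$. A point $\gamma_+\in\partial\Gamma$ is an *attracting fixed point* of $\gamma\in\Gamma$ if it is fixed by $\gamma$ and there is a fixed point $\gamma_-\neq\gamma_+$ of $\gamma$ such that $\gamma^n x\to\gamma_+$ for every $x\ne\gamma_-$. Suppose that $\rho$ is strictly convex. Then: 1. for every $\gamma\in\Gamma$ with $\gamma\ne e$, $\gamma$ has exactly one attracting fixed point $\gamma_+$ in $\partial\Gamma$, the element $\rho(\gamma)$ is proximal, and for every convex pair $(\xi,\eta)$ the line $\xi(\gamma_+)$ is the attracting line of $\rho(\gamma)$; 2. the convex pair $(\xi,\eta)$ is unique; 3. $\xi(x)\subset\eta(x)$ for every $x\in\partial\Gamma$. -/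

import Mathlib

open Filter Topology
open scoped NNReal ENNReal LinearAlgebra.Projectivization

noncomputable section

namespace ConvexRep

/-! ### Gromov hyperbolic spaces and their boundary at infinity -/

/-- Any two points are joined by a geodesic segment. -/
def IsGeodesicSpace (X : Type*) [MetricSpace X] : Prop :=
  ∀ x y : X, ∃ c : ℝ → X, c 0 = x ∧ c (dist x y) = y ∧
    ∀ s ∈ Set.Icc 0 (dist x y), ∀ t ∈ Set.Icc 0 (dist x y), dist (c s) (c t) = |s - t|

/-- The Gromov product `(x|y)_o`. -/
def gromovProduct {X : Type*} [MetricSpace X] (o x y : X) : ℝ :=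
  (dist x o + dist y o - dist x y) / 2

/-- Gromov hyperbolicity (the four point condition). -/
def IsGromovHyperbolic (X : Type*) [MetricSpace X] : Prop :=
  ∃ δ : ℝ, ∀ o x y z : X,
    min (gromovProduct o x y) (gromovProduct o y z) - δ ≤ gromovProduct o x z

/-- Unit speed geodesic rays `[0, ∞) → X`. -/
def GeodesicRay (X : Type*) [MetricSpace X] : Type _ := {r : ℝ≥0 → X // Isometry r}

/-- Two rays are asymptotic if they stay at bounded distance from each other. -/
def asymptoticSetoid (X : Type*) [MetricSpace X] : Setoid (GeodesicRay X) where
  r a b := ∃ K : ℝ, ∀ t, dist (a.1 t) (b.1 t) ≤ K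
  iseqv :=
    { refl := fun a => ⟨0, fun t => by simp⟩
      symm := fun ⟨K, hK⟩ => ⟨K, fun t => by rw [dist_comm]; exact hK t⟩
      trans := fun ⟨K, hK⟩ ⟨L, hL⟩ =>
        ⟨K + L, fun t => (dist_triangle _ _ _).trans (add_le_add (hK t) (hL t))⟩ }

/-- The boundary at infinity: geodesic rays up to bounded distance. -/
def Boundary (X : Type*) [MetricSpace X] : Type _ := Quotient (asymptoticSetoid X)

/-- The point at infinity of a geodesic ray. -/
def Boundary.mk {X : Type*} [MetricSpace X] (a : GeodesicRay X) : Boundary X :=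
  Quotient.mk (asymptoticSetoid X) a

/-- Isometries act on the boundary by translating rays. -/
instance Boundary.instMulAction {Γ X : Type*} [Group Γ] [MetricSpace X] [MulAction Γ X]
    [IsIsometricSMul Γ X] : MulAction Γ (Boundary X) where
  smul g := Quotient.map (sa := asymptoticSetoid X) (sb := asymptoticSetoid X)
    (fun a => ⟨fun t => g • a.1 t, (isometry_smul X g).comp a.2⟩)
    (fun _ _ ⟨K, hK⟩ => ⟨K, fun t => by simpa [dist_smul] using hK t⟩)
  one_smul x := by
    induction x using Quotient.inductionOn with
    | h a => exact congrArg (Boundary.mk (X := X)) (Subtype.ext (funext fun t => one_smul Γ _))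
  mul_smul g h x := by
    induction x using Quotient.inductionOn with
    | h a => exact congrArg (Boundary.mk (X := X)) (Subtype.ext (funext fun t => mul_smul g h _))

/-- The Gromov product of two points at infinity, `sup liminf (a(s)|b(t))_o` over the rays `a`, `b`
representing them; it is `∞` on the diagonal. -/
def boundaryProduct {X : Type*} [MetricSpace X] (o : X) (x y : Boundary X) : ℝ≥0∞ :=
  ⨆ (a : GeodesicRay X) (b : GeodesicRay X) (_ : Boundary.mk a = x) (_ : Boundary.mk b = y),
    liminf (fun p : ℝ≥0 × ℝ≥0 => ENNReal.ofReal (gromovProduct o (a.1 p.1) (b.1 p.2)))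
      (atTop ×ˢ atTop)

/-- Gromov's distance `exp (-(x|y)_o)` on the boundary (with `exp (-∞) = 0`). In general only a
quasi-distance; the metrics `D` with `c⁻¹ ρ ^ ε ≤ D ≤ c ρ ^ ε`, for constants `c, ε > 0` and `ρ` this
function, are the Gromov (visual) metrics. They all have the topology and the Hölder maps described
by `ρ` itself. -/
def gromovDist {X : Type*} [MetricSpace X] (o : X) (x y : Boundary X) : ℝ :=
  if boundaryProduct o x y = ∞ then 0 else Real.exp (-(boundaryProduct o x y).toReal)

/-- `p` is the attracting fixed point of `γ` on the boundary: for some fixed point `q ≠ p`, every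
`x ≠ q` is attracted to `p` under iteration of `γ`. -/
def IsAttractingFixedPoint {Γ X : Type*} [Group Γ] [MetricSpace X] [MulAction Γ X]
    [IsIsometricSMul Γ X] (o : X) (γ : Γ) (p : Boundary X) : Prop :=
  γ • p = p ∧ ∃ q : Boundary X, q ≠ p ∧ γ • q = q ∧
    ∀ x : Boundary X, x ≠ q → Tendsto (fun n : ℕ => gromovDist o (γ ^ n • x) p) atTop (𝓝 0)

/-! ### Lines and hyperplanes of `ℝ^d`, and the action of `PGL(d, ℝ)` -/

/-- Hyperplanes of `ℝ^d`. -/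
def Hyperplane (d : ℕ) : Type := {W : Submodule ℝ (Fin d → ℝ) // Module.finrank ℝ W + 1 = d}

/-- The linear map of `ℝ^d` given by an invertible matrix. -/
def glMap {d : ℕ} (A : GL (Fin d) ℝ) : (Fin d → ℝ) →ₗ[ℝ] (Fin d → ℝ) :=
  Matrix.toLin' (A : Matrix (Fin d) (Fin d) ℝ)

/-- A lift of an element of `PGL(d, ℝ)` to `GL(d, ℝ)`. -/
def lift {d : ℕ} (g : Matrix.ProjGenLinGroup (Fin d) ℝ) : GL (Fin d) ℝ :=
  Function.surjInv Matrix.ProjGenLinGroup.mk_surjective g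

/-- The image of a linear subspace under an element of `PGL(d, ℝ)`. -/
def mapSubspace {d : ℕ} (g : Matrix.ProjGenLinGroup (Fin d) ℝ) (W : Submodule ℝ (Fin d → ℝ)) :
    Submodule ℝ (Fin d → ℝ) :=
  W.map (glMap (lift g))

/-- The image of a subspace does not depend on the lift. -/
theorem mapSubspace_mk {d : ℕ} (A : GL (Fin d) ℝ) (W : Submodule ℝ (Fin d → ℝ)) :
    mapSubspace (Matrix.ProjGenLinGroup.mk A) W = W.map (glMap A) := by
  have h : Matrix.ProjGenLinGroup.mk (lift (Matrix.ProjGenLinGroup.mk A)) =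
      Matrix.ProjGenLinGroup.mk A := Function.surjInv_eq _ _
  obtain ⟨u, hu⟩ := Matrix.ProjGenLinGroup.mk_eq_mk_iff.1 h
  have key : glMap A = (u : ℝ) • glMap (lift (Matrix.ProjGenLinGroup.mk A)) := by
    have hA : (A : Matrix (Fin d) (Fin d) ℝ) =
        (u : ℝ) • (lift (Matrix.ProjGenLinGroup.mk A) : Matrix (Fin d) (Fin d) ℝ) := by
      conv_lhs => rw [← hu]
      simp [Matrix.GeneralLinearGroup.scalar, ← Matrix.smul_eq_mul_diagonal]
    rw [glMap, hA, map_smul]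
    rfl
  rw [key, Submodule.map_smul _ _ _ u.ne_zero]
  rfl

/-- The distance between subspaces of `ℝ^d`: the operator norm of the difference of the Euclidean
orthogonal projections. It gives the usual metric structure of the projective space and of the
Grassmannians, up to bi-Lipschitz equivalence. -/
def subspaceDist {d : ℕ} (V W : Submodule ℝ (Fin d → ℝ)) : ℝ :=
  ‖(V.map (WithLp.linearEquiv 2 ℝ (Fin d → ℝ)).symm.toLinearMap :
      Submodule ℝ (EuclideanSpace ℝ (Fin d))).starProjection -
    (W.map (WithLp.linearEquiv 2 ℝ (Fin d → ℝ)).symm.toLinearMap :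
      Submodule ℝ (EuclideanSpace ℝ (Fin d))).starProjection‖

/-! ### Proximal elements -/

/-- `μ` is the unique complex eigenvalue of `A` of maximal modulus, and its generalized eigenspace
is one dimensional. -/
def IsDominantEigenvalue {d : ℕ} (A : Matrix (Fin d) (Fin d) ℝ) (μ : ℂ) : Prop :=
  Module.End.HasEigenvalue (Matrix.toLin' (A.map Complex.ofReal)) μ ∧
  (∀ ν : ℂ, Module.End.HasEigenvalue (Matrix.toLin' (A.map Complex.ofReal)) ν →
    ν ≠ μ → ‖ν‖ < ‖μ‖) ∧
  Module.finrank ℂ (Module.End.maxGenEigenspace (Matrix.toLin' (A.map Complex.ofReal)) μ) = 1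

/-- `g` is proximal; the condition does not depend on the lift of `g`. -/
def IsProximal {d : ℕ} (g : Matrix.ProjGenLinGroup (Fin d) ℝ) : Prop :=
  ∃ μ : ℂ, IsDominantEigenvalue (lift g : Matrix (Fin d) (Fin d) ℝ) μ

/-- `g` is proximal and `ℓ` is its attracting line, that is, the line of eigenvectors of the
dominant eigenvalue (which is real). -/
def IsAttractingLine {d : ℕ} (g : Matrix.ProjGenLinGroup (Fin d) ℝ) (ℓ : ℙ ℝ (Fin d → ℝ)) : Prop :=
  ∃ a : ℝ, IsDominantEigenvalue (lift g : Matrix (Fin d) (Fin d) ℝ) (a : ℂ) ∧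
    ℓ.submodule = Module.End.eigenspace (glMap (lift g)) a

/-! ### Strictly convex representations -/

/-- Irreducibility: there is no invariant subspace besides `0` and `ℝ^d`. -/
def IsIrreducible {Γ : Type*} [Group Γ] {d : ℕ} (ρ : Γ →* Matrix.ProjGenLinGroup (Fin d) ℝ) :
    Prop :=
  0 < d ∧ ∀ W : Submodule ℝ (Fin d → ℝ), (∀ γ : Γ, mapSubspace (ρ γ) W ≤ W) → W = ⊥ ∨ W = ⊤

/-- A map from the boundary to the subspaces of `ℝ^d` is Hölder continuous. -/
def IsHolder {X : Type*} [MetricSpace X] {d : ℕ} (o : X)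
    (f : Boundary X → Submodule ℝ (Fin d → ℝ)) : Prop :=
  ∃ C r : ℝ, 0 < r ∧ ∀ x y : Boundary X, subspaceDist (f x) (f y) ≤ C * gromovDist o x y ^ r

/-- `(ξ, η)` is a Hölder continuous `ρ`-equivariant map to lines and hyperplanes with
`ℝ^d = ξ(x) ⊕ η(y)` whenever `x ≠ y`. -/
structure IsConvexPair {Γ X : Type*} [Group Γ] [MetricSpace X] [MulAction Γ X]
    [IsIsometricSMul Γ X] {d : ℕ} (o : X) (ρ : Γ →* Matrix.ProjGenLinGroup (Fin d) ℝ)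
    (ξ : Boundary X → ℙ ℝ (Fin d → ℝ)) (η : Boundary X → Hyperplane d) : Prop where
  holder_line : IsHolder o (fun x => (ξ x).submodule)
  holder_hyperplane : IsHolder o (fun x => (η x).1)
  equivariant_line : ∀ (γ : Γ) (x : Boundary X),
    (ξ (γ • x)).submodule = mapSubspace (ρ γ) (ξ x).submodule
  equivariant_hyperplane : ∀ (γ : Γ) (x : Boundary X),
    (η (γ • x)).1 = mapSubspace (ρ γ) (η x).1
  transverse : ∀ x y : Boundary X, x ≠ y → IsCompl (ξ x).submodule (η y).1

/-- A representation is strictly convex if it is irreducible and admits a pair `(ξ, η)`. -/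
def IsStrictlyConvex {Γ X : Type*} [Group Γ] [MetricSpace X] [MulAction Γ X]
    [IsIsometricSMul Γ X] {d : ℕ} (o : X) (ρ : Γ →* Matrix.ProjGenLinGroup (Fin d) ℝ) : Prop :=
  IsIrreducible ρ ∧
    ∃ (ξ : Boundary X → ℙ ℝ (Fin d → ℝ)) (η : Boundary X → Hyperplane d), IsConvexPair o ρ ξ η

end ConvexRep

end

noncomputable section

namespace ConvexRep

/-! ### The Gromov product and the four point condition -/

section Coarse

variable {X : Type*} [MetricSpace X]

/-! The proof transfers north-south dynamics from the boundary to linear algebra. A nontrivial `γ`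
has infinite order, and in a cocompact proper hyperbolic space its orbits do not backtrack: the
products of `γ ^ n • o` and `(γ ^ m)⁻¹ • o` are bounded. Hence forward and backward orbits converge
to distinct boundary points `p` and `q`, which attract under `γ` and `γ⁻¹` respectively
(`exists_northSouth`).

Let `A` lift `ρ γ`, let `e` span `ξ p`, with `A e = a e`, and let `f` be the functional with kernel
`η q` and `f e = 1`. If `y ≠ q`, then `f` does not vanish on `ξ y`, while `ξ (γ ^ n • y)` tends to
`ξ p`; so `a⁻ⁿ Aⁿ v → f(v) e` for `v` in `ξ y`. By irreducibility such lines span, so this holds for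
every vector (`exists_isContracting`). A rank one limit of normalized powers forces a simple
dominant eigenvalue (`dominant_of_tendsto`), which is proximality. It also recovers `ξ p` and `η q`
from `A` alone.

If `ξ q` were not in `η q`, the dominant eigenvalues `a` of `A` and `b` of `A⁻¹` would satisfy `ab =
1`. But a contracting matrix in dimension at least two has `|det A| < |a| ^ d`, and multiplying this
by its analogue for `A⁻¹` gives `1 < 1`.

Inclusion and uniqueness thus hold at the two fixed points of one element. Both are closed invariant
conditions, and the orbit of two distinct boundary points is dense (`exists_tendsto_orbit`), so they
hold everywhere. -/

/-- Gromov hyperbolicity with a given constant. -/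
def HyperbolicWith (X : Type*) [MetricSpace X] (δ : ℝ) : Prop :=
  ∀ o x y z : X, min (gromovProduct o x y) (gromovProduct o y z) - δ ≤ gromovProduct o x z

theorem gromovProduct_comm (o x y : X) : gromovProduct o x y = gromovProduct o y x := by
  unfold gromovProduct
  rw [dist_comm x y]
  ring

theorem gromovProduct_nonneg (o x y : X) : 0 ≤ gromovProduct o x y := by
  unfold gromovProduct
  have := dist_triangle x o y
  rw [dist_comm o y] at this
  linarith

theorem gromovProduct_smul {Γ : Type*} [Group Γ] [MulAction Γ X] [IsIsometricSMul Γ X]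
    (g : Γ) (o x y : X) : gromovProduct (g • o) (g • x) (g • y) = gromovProduct o x y := by
  simp [gromovProduct, dist_smul]

theorem gromovProduct_le_add_dist_right (o x y z : X) :
    gromovProduct o x y ≤ gromovProduct o x z + dist y z := by
  unfold gromovProduct
  have h1 := dist_triangle y z o
  have h2 := dist_triangle x y z
  linarith

theorem gromovProduct_le_add_dist_left (o x y z : X) :
    gromovProduct o x y ≤ gromovProduct o z y + dist x z := by
  rw [gromovProduct_comm o x, gromovProduct_comm o z]
  exact gromovProduct_le_add_dist_right o y x z

theorem gromovProduct_le_add_dist_base (o o' x y : X) :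
    gromovProduct o x y ≤ gromovProduct o' x y + dist o o' := by
  unfold gromovProduct
  have h1 := dist_triangle x o' o
  have h2 := dist_triangle y o' o
  rw [dist_comm o' o] at h1 h2
  linarith

/-- Changing the base point to one of the two points. -/
theorem gromovProduct_add_swap (o x y : X) :
    gromovProduct o x y + gromovProduct x o y = dist o x := by
  unfold gromovProduct
  rw [dist_comm x o, dist_comm y o, dist_comm y x]
  ring

theorem HyperbolicWith.nonneg {δ : ℝ} (h : HyperbolicWith X δ) (o : X) : 0 ≤ δ := by
  have := h o o o o
  simp only [gromovProduct, dist_self] at this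
  norm_num at this
  exact this

/-- The four point condition in its symmetric form. -/
theorem HyperbolicWith.four_point {δ : ℝ} (h : HyperbolicWith X δ) (x y z w : X) :
    dist x z + dist y w ≤ max (dist x y + dist z w) (dist x w + dist y z) + 2 * δ := by
  have := h w x y z
  unfold gromovProduct at this
  rcases min_cases ((dist x w + dist y w - dist x y) / 2) ((dist y w + dist z w - dist y z) / 2)
    with ⟨h1, _⟩ | ⟨h1, _⟩ <;> rw [h1] at this
  · have := le_max_left (dist x y + dist z w) (dist x w + dist y z)
    linarith
  · have := le_max_right (dist x y + dist z w) (dist x w + dist y z)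
    linarith

theorem HyperbolicWith.le_or_le {δ : ℝ} (h : HyperbolicWith X δ) (o x y z : X) :
    gromovProduct o x y ≤ gromovProduct o x z + δ ∨
      gromovProduct o y z ≤ gromovProduct o x z + δ := by
  have := h o x y z
  rcases min_cases (gromovProduct o x y) (gromovProduct o y z) with ⟨h1, _⟩ | ⟨h1, _⟩ <;>
    rw [h1] at this
  · left; linarith
  · right; linarith

theorem HyperbolicWith.le_trans {δ N : ℝ} (h : HyperbolicWith X δ) {o x y z : X}
    (h1 : N ≤ gromovProduct o x y) (h2 : N ≤ gromovProduct o y z) :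
    N - δ ≤ gromovProduct o x z := by
  rcases h.le_or_le o x y z with h3 | h3 <;> linarith

/-! ### Local-to-global for orbits -/

/-- A discrete homogeneous path whose second steps are definitely longer than its first steps
makes definite progress, and does not backtrack. -/
theorem HyperbolicWith.chain_step {δ C : ℝ} (h : HyperbolicWith X δ) (u : ℤ → X)
    (hu : ∀ i j k, dist (u (i + k)) (u (j + k)) = dist (u i) (u j))
    (hC : 2 * δ < C) (hlong : dist (u 0) (u 1) + C ≤ dist (u 0) (u 2)) (n : ℕ) :
    gromovProduct (u n) (u 0) (u (n + 1)) ≤ dist (u 0) (u 1) / 2 - C / 2 + δ := by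
  have hL : ∀ i : ℤ, dist (u i) (u (i + 1)) = dist (u 0) (u 1) := fun i => by
    have := hu 0 1 i
    rwa [zero_add, add_comm 1 i] at this
  have hL2 : ∀ i : ℤ, dist (u i) (u (i + 1 + 1)) = dist (u 0) (u 2) := fun i => by
    have := hu 0 2 i
    rwa [zero_add, add_comm 2 i, show i + 2 = i + 1 + 1 by ring] at this
  have hδ := h.nonneg (u 0)
  induction n with
  | zero =>
    have h2 := dist_triangle (u 0) (u 1) (u 2)
    have h3 := hL 1
    norm_num at h3
    simp only [gromovProduct, Nat.cast_zero, zero_add, dist_self, dist_comm (u 1) (u 0)]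
    linarith
  | succ n ih =>
    push_cast
    have e1 := hL n
    have e2 := hL (n + 1)
    have e3 := hL2 n
    -- With `L` the step length, the first alternative is impossible: by induction the product of `u
    -- n` and `u 0` based at `u (n + 1)` is at least `L / 2 + C / 2 - δ`, too large because `C > 2 *
    -- δ`.
    have key := h.le_or_le (u (n + 1)) (u n) (u 0) (u (n + 1 + 1))
    have hs : gromovProduct (u (n + 1)) (u n) (u (n + 1 + 1)) ≤ dist (u 0) (u 1) / 2 - C / 2 := by
      unfold gromovProduct
      rw [dist_comm (u (n + 1 + 1)) (u (n + 1)), e1, e2, e3]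
      linarith
    have hb : gromovProduct (u (n + 1)) (u n) (u 0) + gromovProduct (u n) (u 0) (u (n + 1)) =
        dist (u 0) (u 1) := by
      rw [gromovProduct_comm (u n), gromovProduct_add_swap, dist_comm, e1]
    rcases key with k | k <;> linarith

/-- Compare both ends with the neighbour `u (-1)`. The one-sided estimate makes `u (-1)` and `u
(-m)` have a large product at `u 0`, and `u (-1)` and `u n` a small one; the four point condition
then bounds the remaining product. The extra `δ` is why `C > 3 * δ` is needed. -/
theorem HyperbolicWith.chain_bounded {δ C : ℝ} (h : HyperbolicWith X δ) (u : ℤ → X)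
    (hu : ∀ i j k, dist (u (i + k)) (u (j + k)) = dist (u i) (u j))
    (hC : 3 * δ < C) (hlong : dist (u 0) (u 1) + C ≤ dist (u 0) (u 2)) (m n : ℕ) :
    gromovProduct (u 0) (u (-m)) (u n) ≤ dist (u 0) (u 1) / 2 - C / 2 + 2 * δ := by
  have hδ := h.nonneg (u 0)
  have hgp : ∀ i j k l, gromovProduct (u (i + l)) (u (j + l)) (u (k + l)) =
      gromovProduct (u i) (u j) (u k) := fun i j k l => by simp [gromovProduct, hu]
  have hL1 : dist (u 0) (u (-1)) = dist (u 0) (u 1) := by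
    have := hu 0 1 (-1)
    simp only [zero_add, add_neg_cancel] at this
    rw [dist_comm, this]
  have hL2 : dist (u 0) (u (-2)) = dist (u 0) (u 2) := by
    have := hu 0 2 (-2)
    simp only [zero_add, add_neg_cancel] at this
    rw [dist_comm, this]
  have right : ∀ n : ℕ, gromovProduct (u 0) (u 1) (u (-n)) ≤
      dist (u 0) (u 1) / 2 - C / 2 + δ := fun n => by
    have := h.chain_step u hu (by linarith) hlong n
    rw [← hgp _ _ _ (-n : ℤ), gromovProduct_comm] at this
    simpa using this
  have left : ∀ n : ℕ, gromovProduct (u 0) (u (-1)) (u n) ≤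
      dist (u 0) (u 1) / 2 - C / 2 + δ := fun n => by
    have := h.chain_step (fun i => u (-i)) (fun i j k => by
      simp only [neg_add]; exact hu _ _ _) (C := C) (by linarith)
      (by simp only [neg_zero]; rw [hL1, hL2]; exact hlong) n
    simp only [neg_zero, hL1] at this
    rw [← hgp _ _ _ (n : ℤ), gromovProduct_comm] at this
    simpa using this
  have h2 := dist_triangle (u 0) (u 1) (u 2)
  have h3 := hu 0 1 1
  norm_num at h3
  rcases m with _ | m
  · simp only [gromovProduct, Nat.cast_zero, neg_zero, dist_self, dist_comm (u n) (u 0)]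
    linarith
  · have key := h.le_or_le (u 0) (u (-1)) (u (-(m + 1 : ℕ))) (u n)
    have h4 := gromovProduct_add_swap (u 0) (u (-1)) (u (-(m + 1 : ℕ)))
    have h5 : gromovProduct (u (-1)) (u 0) (u (-(m + 1 : ℕ))) =
        gromovProduct (u 0) (u 1) (u (-m)) := by
      have e : (-((m + 1 : ℕ) : ℤ) + 1) = -m := by push_cast; ring
      rw [← hgp _ _ _ 1, e]
      norm_num
    have h6 := left n
    have h7 := right m
    generalize u (-(m + 1 : ℕ)) = w at h4 h5 key ⊢
    rcases key with k | k <;> linarith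

/-! ### Infinite order elements of cocompact groups -/

variable {Γ : Type*} [Group Γ] [MulAction Γ X]

theorem finite_dist_smul_le [ProperSpace X] [ProperlyDiscontinuousSMul Γ X] (o : X) (R : ℝ) :
    {g : Γ | ∃ x, dist x o ≤ R ∧ dist (g • x) o ≤ R}.Finite := by
  refine (ProperlyDiscontinuousSMul.finite_disjoint_inter_image (Γ := Γ)
    (isCompact_closedBall o R) (isCompact_closedBall o R)).subset ?_
  rintro g ⟨x, hx, hgx⟩
  exact ⟨g • x, ⟨x, hx, rfl⟩, hgx⟩

theorem exists_dist_le_of_cocompact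
    (hcocompact : ∃ K : Set X, IsCompact K ∧ ∀ x : X, ∃ γ : Γ, γ • x ∈ K) (o : X) :
    ∃ R : ℝ, ∀ x : X, ∃ γ : Γ, dist (γ • x) o ≤ R := by
  obtain ⟨K, hK, hcov⟩ := hcocompact
  obtain ⟨R, hR⟩ := hK.isBounded.subset_closedBall o
  exact ⟨R, fun x => (hcov x).imp fun γ h => hR h⟩

theorem exists_lt_dist_pow_smul [ProperSpace X] [ProperlyDiscontinuousSMul Γ X] (o : X) {γ : Γ}
    (hγ : ¬ IsOfFinOrder γ) (R : ℝ) : ∃ n : ℕ, R < dist o (γ ^ n • o) := by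
  by_contra! hcon
  have hR : 0 ≤ R := dist_nonneg.trans (hcon 0)
  refine Set.infinite_range_of_injective (injective_pow_iff_not_isOfFinOrder.2 hγ)
    ((finite_dist_smul_le (Γ := Γ) o R).subset ?_)
  rintro _ ⟨n, rfl⟩
  exact ⟨o, by simpa using hR, by rw [dist_comm]; exact hcon n⟩

variable [IsIsometricSMul Γ X]

/-- If long powers of `γ` almost fix the long segment from `o` to `γ ^ m • o` and all double steps
are short, then the midpoint of the segment is moved a bounded amount. -/
theorem HyperbolicWith.dist_midpoint_le {δ C R D : ℝ} (h : HyperbolicWith X δ) {γ : Γ}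
    {o x : X} {m j : ℕ}
    (hx1 : dist x o = D) (hx2 : dist x (γ ^ m • o) = D) (hm : dist o (γ ^ m • o) = 2 * D)
    (hD : 4 * R + 100 * δ < D) (hj : dist o (γ ^ j • o) ≤ R) (hjj : dist o (γ ^ (2 * j) • o) ≤ R)
    (hshort : dist x (γ ^ (2 * j) • x) ≤ dist x (γ ^ j • x) + C) :
    dist x (γ ^ j • x) ≤ 14 * δ + C := by
  have hδ := h.nonneg o
  obtain ⟨A1, hA1⟩ : ∃ p, p = γ ^ j • o := ⟨_, rfl⟩
  obtain ⟨B, hB⟩ : ∃ p, p = γ ^ m • o := ⟨_, rfl⟩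
  obtain ⟨B1, hB1⟩ : ∃ p, p = γ ^ j • B := ⟨_, rfl⟩
  obtain ⟨y, hy⟩ : ∃ p, p = γ ^ j • x := ⟨_, rfl⟩
  obtain ⟨z, hz⟩ : ∃ p, p = γ ^ (2 * j) • x := ⟨_, rfl⟩
  obtain ⟨A2, hA2⟩ : ∃ p, p = γ ^ (2 * j) • o := ⟨_, rfl⟩
  have hz' : z = γ ^ j • y := by rw [hz, hy, smul_smul, ← pow_add, two_mul]
  rw [← hB] at hx2 hm
  rw [← hA1] at hj
  rw [← hA2] at hjj
  rw [← hy, ← hz] at hshort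
  rw [← hy]
  have hBB : dist B B1 ≤ R := by
    rw [hB1, hB, smul_smul, ← pow_add, add_comm, pow_add, ← smul_smul, dist_smul, ← hA1]
    exact hj
  have f1 : dist y A1 = D := by rw [hy, hA1, dist_smul, hx1]
  have f2 : dist y B1 = D := by rw [hy, hB1, dist_smul, hx2]
  have f3 : dist A1 B1 = 2 * D := by rw [hA1, hB1, dist_smul, hm]
  have f4 : dist z A2 = D := by rw [hz, hA2, dist_smul, hx1]
  have f5 : dist z A1 = dist y o := by rw [hz', hA1, dist_smul]
  have f6 : dist y z = dist x y := by rw [hz', hy, dist_smul]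
  have R0 : 0 ≤ R := dist_nonneg.trans hj
  have g1 := dist_triangle y A1 o
  have g2 := dist_triangle y o A1
  have g3 := dist_triangle y B1 B
  have g4 := dist_triangle y B B1
  have g5 := dist_triangle z A2 o
  have g6 := dist_triangle z o A2
  rw [dist_comm A1 o] at g1
  rw [dist_comm B1 B] at g3
  rw [dist_comm A2 o] at g5
  -- `y` is the midpoint of a segment whose ends are `R`-close to `o` and `B`. Since `D` is much
  -- larger than `R` and `δ`, `y` nearly lies on the segment from `o` to `B`, with an error in `δ`
  -- only.
  have s1 : dist y o + dist y B ≤ 2 * D + 4 * δ := by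
    have k1 := h.le_or_le y A1 o B
    have k2 := h.le_or_le y A1 B B1
    simp only [gromovProduct, dist_comm _ y] at k1 k2
    rw [dist_comm A1 o] at k1
    have t1 := dist_triangle A1 o B
    have t2 := dist_triangle A1 B1 B
    rw [dist_comm A1 o] at t1
    rcases k1 with k1 | k1 <;> rcases k2 with k2 | k2 <;> linarith
  have s2 : dist x y ≤ |dist y o - D| + 6 * δ := by
    have k := h.four_point o x B y
    rw [dist_comm o x, dist_comm B y, dist_comm o y, hx1, hx2, hm] at k
    have := le_abs_self (dist y o - D)
    have := neg_le_abs (dist y o - D)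
    rcases max_cases (D + dist y B) (dist y o + D) with ⟨e, _⟩ | ⟨e, _⟩ <;> rw [e] at k <;> linarith
  have ha : |dist y o - D| ≤ R := by rw [abs_le]; constructor <;> linarith
  -- These give `dist z o - D = 2 * (dist y o - D)` up to `2 * δ`: the signed shift along the
  -- segment doubles. With `t` this shift for `y`, `2 * |t| - 2 * δ ≤ dist x z ≤ dist x y + C ≤ |t|
  -- + 6 * δ + C`, so `|t| ≤ 8 * δ + C`.
  have k1 := h.four_point z y A1 o
  have k2 := h.four_point z y o A1
  rw [dist_comm A1 o, dist_comm z y, f6, f1, f5] at k1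
  rw [dist_comm z y, f6, f1, f5] at k2
  have l1 : 2 * (dist y o) ≤ dist z o + D + 2 * δ := by
    rcases max_cases (dist x y + dist o A1) (dist z o + D) with ⟨e, _⟩ | ⟨e, _⟩ <;>
      rw [e] at k1 <;> linarith
  have l2 : dist z o + D ≤ 2 * dist y o + 2 * δ := by
    rcases max_cases (dist x y + dist o A1) (dist y o + dist y o) with ⟨e, _⟩ | ⟨e, _⟩ <;>
      rw [e] at k2 <;> linarith
  have t1 := dist_triangle z x o
  have t2 := dist_triangle x z o
  rw [dist_comm z x] at t1
  rcases abs_cases (dist y o - D) with ⟨e, _⟩ | ⟨e, _⟩ <;> rw [e] at s2 <;> linarith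

/-- Some power of an infinite order element makes definite progress somewhere. -/
theorem HyperbolicWith.exists_long_power [ProperSpace X] [ProperlyDiscontinuousSMul Γ X]
    (hgeod : IsGeodesicSpace X) {δ : ℝ} (h : HyperbolicWith X δ) (o : X)
    (hcocompact : ∃ K : Set X, IsCompact K ∧ ∀ x : X, ∃ γ : Γ, γ • x ∈ K)
    {γ : Γ} (hγ : ¬ IsOfFinOrder γ) (C : ℝ) (hC : 0 ≤ C) :
    ∃ (k : ℕ) (x : X), 0 < k ∧ dist x (γ ^ k • x) + C ≤ dist x (γ ^ (2 * k) • x) := by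
  by_contra! hcon
  have hδ := h.nonneg o
  obtain ⟨R, hR⟩ := exists_dist_le_of_cocompact hcocompact o
  -- Pigeonhole: only `n` elements can move a point of this ball to another point of it, yet a
  -- distant midpoint, brought back by cocompactness, will give `n + 1` of them.
  have hfin := finite_dist_smul_le (Γ := Γ) o (R + (14 * δ + C))
  obtain ⟨n, hn⟩ : ∃ n, n = hfin.toFinset.card := ⟨_, rfl⟩
  obtain ⟨S, hS⟩ : ∃ S : ℝ, ∀ j ≤ 2 * n, dist o (γ ^ j • o) ≤ S := by
    refine ⟨∑ j ∈ Finset.range (2 * n + 1), dist o (γ ^ j • o), fun j hj => ?_⟩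
    exact Finset.single_le_sum (f := fun j => dist o (γ ^ j • o)) (fun _ _ => dist_nonneg)
      (Finset.mem_range.2 (by omega))
  obtain ⟨m, hm⟩ := exists_lt_dist_pow_smul o hγ (2 * (4 * S + 100 * δ))
  obtain ⟨c, hc0, hc1, hc⟩ := hgeod o (γ ^ m • o)
  set D := dist o (γ ^ m • o) / 2 with hDdef
  have hD2 : dist o (γ ^ m • o) = 2 * D := by rw [hDdef]; ring
  have hD0 : 0 ≤ D := by have := dist_nonneg (x := o) (y := γ ^ m • o); linarith
  have hx1 : dist (c D) o = D := by
    rw [← hc0, hc D ⟨hD0, by linarith⟩ 0 ⟨le_rfl, dist_nonneg⟩, sub_zero, abs_of_nonneg hD0]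
  have hx2 : dist (c D) (γ ^ m • o) = D := by
    conv_lhs => rw [← hc1]
    rw [hc D ⟨hD0, by linarith⟩ _ ⟨dist_nonneg, le_rfl⟩, hD2, abs_sub_comm, abs_of_nonneg] <;>
      linarith
  have hbd : ∀ j ≤ n, dist (c D) (γ ^ j • c D) ≤ 14 * δ + C := by
    intro j hj
    rcases Nat.eq_zero_or_pos j with rfl | hj0
    · simp only [pow_zero, one_smul, dist_self]; linarith
    · exact h.dist_midpoint_le hx1 hx2 hD2 (by linarith) (hS j (by omega)) (hS _ (by omega))
        (hcon j (c D) hj0).le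
  obtain ⟨g, hg⟩ := hR (c D)
  have hle : (Finset.range (n + 1)).card ≤ hfin.toFinset.card := by
    refine Finset.card_le_card_of_injOn (fun j => g * γ ^ j * g⁻¹) ?_ ?_
    · intro j hj
      have hj' : j ≤ n := by simpa [Nat.lt_succ_iff] using hj
      simp only [Set.Finite.coe_toFinset, Set.mem_ofPred_eq]
      refine ⟨g • c D, by linarith, ?_⟩
      rw [smul_smul, inv_mul_cancel_right, ← smul_smul]
      have := dist_triangle (g • γ ^ j • c D) (g • c D) o
      rw [dist_smul, dist_comm (γ ^ j • c D)] at this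
      linarith [hbd j hj']
    · intro i _ j _ hij
      exact injective_pow_iff_not_isOfFinOrder.2 hγ (by simpa using hij)
  rw [Finset.card_range] at hle
  omega

/-- The orbit of an infinite order element does not backtrack. -/
theorem HyperbolicWith.exists_gromovProduct_orbit_le [ProperSpace X]
    [ProperlyDiscontinuousSMul Γ X]
    (hgeod : IsGeodesicSpace X) {δ : ℝ} (h : HyperbolicWith X δ) (o : X)
    (hcocompact : ∃ K : Set X, IsCompact K ∧ ∀ x : X, ∃ γ : Γ, γ • x ∈ K)
    {γ : Γ} (hγ : ¬ IsOfFinOrder γ) :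
    ∃ M : ℝ, ∀ m n : ℕ, gromovProduct o ((γ ^ m)⁻¹ • o) (γ ^ n • o) ≤ M := by
  have hδ := h.nonneg o
  -- Any excess above `3 * δ` would do for the local-to-global step.
  obtain ⟨k, x, hk, hlong⟩ := h.exists_long_power hgeod o hcocompact hγ (4 * δ + 1) (by linarith)
  set η : Γ := γ ^ k with hη
  have hu : ∀ i j l : ℤ, dist (η ^ (i + l) • x) (η ^ (j + l) • x) =
      dist (η ^ i • x) (η ^ j • x) := fun i j l => by
    rw [add_comm i, add_comm j, zpow_add, zpow_add, ← smul_smul, ← smul_smul, dist_smul]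
  have hb := h.chain_bounded (fun i => η ^ i • x) hu (C := 4 * δ + 1) (by linarith) (by
    simp only [zpow_zero, one_smul, zpow_one]
    rw [show (2 : ℤ) = (2 : ℕ) by rfl, zpow_natCast, hη, ← pow_mul, mul_comm k]
    exact hlong)
  simp only [zpow_zero, one_smul, zpow_neg, zpow_natCast, zpow_one] at hb
  set M := dist x (η • x) / 2 - (4 * δ + 1) / 2 + 2 * δ
  set S := ∑ j ∈ Finset.range k, (dist x (γ ^ j • o) + dist x ((γ ^ j)⁻¹ • o))
  have hS : ∀ j < k, dist x (γ ^ j • o) + dist x ((γ ^ j)⁻¹ • o) ≤ S := fun j hj =>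
    Finset.single_le_sum (f := fun j => dist x (γ ^ j • o) + dist x ((γ ^ j)⁻¹ • o))
      (fun _ _ => add_nonneg dist_nonneg dist_nonneg) (Finset.mem_range.2 hj)
  -- Orbits of `γ` stay within `S` of orbits of `η = γ ^ k`, by division with remainder.
  have hpow : ∀ n : ℕ, γ ^ n = η ^ (n / k) * γ ^ (n % k) := fun n => by
    rw [hη, ← pow_mul, ← pow_add, Nat.div_add_mod]
  have h1 : ∀ n : ℕ, dist (γ ^ n • o) (η ^ (n / k) • x) ≤ S := fun n => by
    rw [hpow n, ← smul_smul, dist_smul, dist_comm]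
    exact (le_add_of_nonneg_right dist_nonneg).trans (hS _ (Nat.mod_lt _ hk))
  have h2 : ∀ n : ℕ, dist ((γ ^ n)⁻¹ • o) ((η ^ (n / k))⁻¹ • x) ≤ S := fun n => by
    have : (γ ^ n)⁻¹ = (η ^ (n / k))⁻¹ * (γ ^ (n % k))⁻¹ := by
      rw [← mul_inv_rev, hη, ← pow_mul, ← pow_add, Nat.mod_add_div]
    rw [this, ← smul_smul, dist_smul, dist_comm]
    exact (le_add_of_nonneg_left dist_nonneg).trans (hS _ (Nat.mod_lt _ hk))
  refine ⟨M + S + S + dist o x, fun m n => ?_⟩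
  have e1 := gromovProduct_le_add_dist_base o x ((γ ^ m)⁻¹ • o) (γ ^ n • o)
  have e2 := gromovProduct_le_add_dist_left x ((γ ^ m)⁻¹ • o) (γ ^ n • o) ((η ^ (m / k))⁻¹ • x)
  have e3 := gromovProduct_le_add_dist_right x ((η ^ (m / k))⁻¹ • x) (γ ^ n • o) (η ^ (n / k) • x)
  linarith [hb (m / k) (n / k), h1 n, h2 m]

end Coarse

/-! ### Geodesic rays and convergence to the boundary -/

section Rays

variable {X : Type*} [MetricSpace X]

theorem GeodesicRay.dist_eq (a : GeodesicRay X) (s t : ℝ≥0) :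
    dist (a.1 s) (a.1 t) = |(s : ℝ) - t| := by
  rw [a.2.dist_eq, NNReal.dist_eq]

theorem GeodesicRay.le_dist (a : GeodesicRay X) (o : X) (s : ℝ≥0) :
    (s : ℝ) - dist o (a.1 0) ≤ dist (a.1 s) o := by
  have h1 := dist_triangle (a.1 s) o (a.1 0)
  rw [a.dist_eq, NNReal.coe_zero, sub_zero, abs_of_nonneg s.coe_nonneg] at h1
  linarith

theorem GeodesicRay.dist_le (a : GeodesicRay X) (o : X) (s : ℝ≥0) :
    dist (a.1 s) o ≤ s + dist o (a.1 0) := by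
  have h1 := dist_triangle (a.1 s) (a.1 0) o
  rw [a.dist_eq, NNReal.coe_zero, sub_zero, abs_of_nonneg s.coe_nonneg, dist_comm (a.1 0) o] at h1
  linarith

theorem GeodesicRay.le_gromovProduct (a : GeodesicRay X) (o : X) {N : ℝ} {s t : ℝ≥0}
    (hs : N ≤ s) (ht : N ≤ t) : N - dist o (a.1 0) ≤ gromovProduct o (a.1 s) (a.1 t) := by
  unfold gromovProduct
  have h1 := a.le_dist o s
  have h2 := a.le_dist o t
  rw [a.dist_eq]
  rcases abs_cases ((s : ℝ) - t) with ⟨e, _⟩ | ⟨e, _⟩ <;> rw [e] <;> linarith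

theorem gromovProduct_le_dist_left (o x y : X) : gromovProduct o x y ≤ dist x o := by
  have := gromovProduct_add_swap o x y
  have h2 := gromovProduct_nonneg x o y
  rw [dist_comm]
  linarith

theorem gromovProduct_le_dist_right (o x y : X) : gromovProduct o x y ≤ dist y o := by
  rw [gromovProduct_comm]
  exact gromovProduct_le_dist_left o y x

theorem Boundary.exists_mk (x : Boundary X) : ∃ a : GeodesicRay X, Boundary.mk a = x :=
  Quotient.exists_rep x

theorem Boundary.mk_eq_mk {a b : GeodesicRay X} :
    Boundary.mk a = Boundary.mk b ↔ ∃ K : ℝ, ∀ t, dist (a.1 t) (b.1 t) ≤ K :=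
  Quotient.eq

/-- The Gromov products of points on asymptotic rays tend to infinity. -/
theorem exists_forall_le_gromovProduct_of_mk_eq (o : X) {a b : GeodesicRay X}
    (h : Boundary.mk a = Boundary.mk b) (N : ℝ) :
    ∃ T : ℝ≥0, ∀ s ≥ T, ∀ t ≥ T, N ≤ gromovProduct o (a.1 s) (b.1 t) := by
  obtain ⟨K, hK⟩ := Boundary.mk_eq_mk.1 h
  refine ⟨Real.toNNReal (N + K + dist o (a.1 0)), fun s hs t ht => ?_⟩
  have hs' : N + K + dist o (a.1 0) ≤ s := (Real.le_coe_toNNReal _).trans (NNReal.coe_le_coe.2 hs)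
  have ht' : N + K + dist o (a.1 0) ≤ t := (Real.le_coe_toNNReal _).trans (NNReal.coe_le_coe.2 ht)
  have h1 := a.le_gromovProduct o hs' ht'
  have h2 := gromovProduct_le_add_dist_right o (a.1 s) (a.1 t) (b.1 t)
  linarith [hK t]

/-- Rays with unbounded Gromov products are asymptotic. -/
theorem HyperbolicWith.mk_eq_mk {δ : ℝ} (h : HyperbolicWith X δ) (o : X) {a b : GeodesicRay X}
    (hab : ∀ N : ℝ, ∃ s t, N ≤ gromovProduct o (a.1 s) (b.1 t)) :
    Boundary.mk a = Boundary.mk b := by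
  have hδ := h.nonneg o
  set A := dist o (a.1 0) with hA
  set B := dist o (b.1 0) with hB
  have hA0 : 0 ≤ A := dist_nonneg
  have hB0 : 0 ≤ B := dist_nonneg
  refine Boundary.mk_eq_mk.2 ⟨3 * A + 3 * B + 4 * δ, fun t => ?_⟩
  -- So large a product forces both `s` and `s'` beyond `t`; then `a t` and `b t` are compared
  -- through `a s` and `b s'`, at a cost of `2 * δ`.
  obtain ⟨s, s', hss⟩ := hab (t + A + B)
  have h1 : (t : ℝ) ≤ s := by
    have := gromovProduct_le_dist_left o (a.1 s) (b.1 s')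
    have := a.dist_le o s
    linarith
  have h2 : (t : ℝ) ≤ s' := by
    have := gromovProduct_le_dist_right o (a.1 s) (b.1 s')
    have := b.dist_le o s'
    linarith
  have h3 := a.le_gromovProduct o le_rfl h1
  have h4 := b.le_gromovProduct o h2 le_rfl
  have h5 : (t : ℝ) - A - B - δ ≤ gromovProduct o (a.1 t) (b.1 s') :=
    h.le_trans (y := a.1 s) (by linarith) (by linarith)
  have h6 : (t : ℝ) - A - B - δ - δ ≤ gromovProduct o (a.1 t) (b.1 t) :=
    h.le_trans (y := b.1 s') h5 (by linarith)
  unfold gromovProduct at h6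
  have h7 := a.dist_le o t
  have h8 := b.dist_le o t
  linarith

theorem HyperbolicWith.exists_forall_lt {δ : ℝ} (h : HyperbolicWith X δ) (o : X)
    {a b : GeodesicRay X} (hab : Boundary.mk a ≠ Boundary.mk b) :
    ∃ M : ℝ, ∀ s t, gromovProduct o (a.1 s) (b.1 t) < M := by
  by_contra! hcon
  exact hab (h.mk_eq_mk o hcon)

/-! ### Small Gromov distances -/

theorem gromovDist_le_exp (o : X) {a b : GeodesicRay X} {N : ℝ}
    (h : ∃ T : ℝ≥0, ∀ s ≥ T, ∀ t ≥ T, N ≤ gromovProduct o (a.1 s) (b.1 t)) :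
    gromovDist o (Boundary.mk a) (Boundary.mk b) ≤ Real.exp (-N) := by
  unfold gromovDist
  split_ifs with htop
  · exact (Real.exp_pos _).le
  · refine Real.exp_le_exp.2 (neg_le_neg ?_)
    refine (ENNReal.ofReal_le_iff_le_toReal htop).1 ?_
    unfold boundaryProduct
    refine le_iSup_of_le a (le_iSup_of_le b (le_iSup_of_le rfl (le_iSup_of_le rfl ?_)))
    obtain ⟨T, hT⟩ := h
    refine le_liminf_of_le (by isBoundedDefault) ?_
    filter_upwards [prod_mem_prod (Ici_mem_atTop T) (Ici_mem_atTop T)] with p hp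
    exact ENNReal.ofReal_le_ofReal (hT _ hp.1 _ hp.2)

theorem gromovDist_nonneg (o : X) (x y : Boundary X) : 0 ≤ gromovDist o x y := by
  unfold gromovDist
  split_ifs
  · exact le_rfl
  · exact (Real.exp_pos _).le

theorem tendsto_gromovDist_zero (o : X) {x : ℕ → Boundary X} {a : GeodesicRay X}
    (h : ∀ N : ℝ, ∀ᶠ n in atTop, ∃ b : GeodesicRay X, Boundary.mk b = x n ∧
      ∃ T : ℝ≥0, ∀ s ≥ T, ∀ t ≥ T, N ≤ gromovProduct o (b.1 s) (a.1 t)) :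
    Tendsto (fun n => gromovDist o (x n) (Boundary.mk a)) atTop (𝓝 0) := by
  refine tendsto_order.2 ⟨fun r hr => ?_, fun r hr => ?_⟩
  · exact Eventually.of_forall fun n => hr.trans_le (gromovDist_nonneg _ _ _)
  · filter_upwards [h (-Real.log (r / 2))] with n hn
    obtain ⟨b, hb, hT⟩ := hn
    rw [← hb]
    refine (gromovDist_le_exp o hT).trans_lt ?_
    rw [neg_neg, Real.exp_log (by positivity)]
    linarith

theorem exists_le_gromovProduct_of_gromovDist_lt (o : X) {x y : Boundary X} {N : ℝ} (hN : 0 ≤ N)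
    (h : gromovDist o x y < Real.exp (-N)) :
    ∃ a b : GeodesicRay X, Boundary.mk a = x ∧ Boundary.mk b = y ∧
      ∃ T : ℝ≥0, ∀ s ≥ T, ∀ t ≥ T, N ≤ gromovProduct o (a.1 s) (b.1 t) := by
  have hlt : ENNReal.ofReal N < boundaryProduct o x y := by
    unfold gromovDist at h
    split_ifs at h with htop
    · rw [htop]; exact ENNReal.ofReal_lt_top
    · rw [ENNReal.ofReal_lt_iff_lt_toReal hN htop]
      linarith [Real.exp_lt_exp.1 h]
  unfold boundaryProduct at hlt
  simp only [lt_iSup_iff] at hlt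
  obtain ⟨a, b, ha, hb, hl⟩ := hlt
  refine ⟨a, b, ha, hb, ?_⟩
  have hev := eventually_lt_of_lt_liminf hl
  rw [prod_atTop_atTop_eq, eventually_atTop] at hev
  obtain ⟨⟨T1, T2⟩, hT⟩ := hev
  refine ⟨max T1 T2, fun s hs t ht => ?_⟩
  have := hT (s, t) ⟨(le_max_left _ _).trans hs, (le_max_right _ _).trans ht⟩
  exact ((ENNReal.ofReal_lt_ofReal_iff_of_nonneg hN).1 this).le

/-- The boundary product is a supremum over representing rays, so each smallness hypothesis brings
its own rays. Passing between them makes a chain of five large products, whence four uses of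
hyperbolicity and the margin `4 * δ`. -/
theorem HyperbolicWith.eq_of_gromovDist_lt {δ : ℝ} (h : HyperbolicWith X δ) (o : X)
    {y z : Boundary X} (hyz : ∀ N : ℝ, 0 ≤ N → ∃ x, gromovDist o x y < Real.exp (-N) ∧
      gromovDist o x z < Real.exp (-N)) : y = z := by
  obtain ⟨a, rfl⟩ := y.exists_mk
  obtain ⟨c, rfl⟩ := z.exists_mk
  refine h.mk_eq_mk o fun N => ?_
  have hδ := h.nonneg o
  obtain ⟨x, hx1, hx2⟩ := hyz (max N 0 + 4 * δ) (by have := le_max_right N 0; linarith)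
  have hpos : 0 ≤ max N 0 + 4 * δ := by have := le_max_right N 0; linarith
  obtain ⟨b1, a1, hb1, ha1, T1, hT1⟩ := exists_le_gromovProduct_of_gromovDist_lt o hpos hx1
  obtain ⟨b2, c2, hb2, hc2, T2, hT2⟩ := exists_le_gromovProduct_of_gromovDist_lt o hpos hx2
  obtain ⟨T3, hT3⟩ := exists_forall_le_gromovProduct_of_mk_eq o ha1.symm (max N 0 + 4 * δ)
  obtain ⟨T4, hT4⟩ := exists_forall_le_gromovProduct_of_mk_eq o (hb1.trans hb2.symm)
    (max N 0 + 4 * δ)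
  obtain ⟨T5, hT5⟩ := exists_forall_le_gromovProduct_of_mk_eq o hc2 (max N 0 + 4 * δ)
  obtain ⟨T, h1, h2, h3, h4, h5⟩ : ∃ T, T1 ≤ T ∧ T2 ≤ T ∧ T3 ≤ T ∧ T4 ≤ T ∧ T5 ≤ T :=
    ⟨max T1 (max T2 (max T3 (max T4 T5))), by simp, by simp, by simp, by simp, by simp⟩
  have k1 := hT3 T h3 T h3
  have k2 := hT1 T h1 T h1
  have k3 := hT4 T h4 T h4
  have k4 := hT2 T h2 T h2
  have k5 := hT5 T h5 T h5
  rw [gromovProduct_comm] at k2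
  have l1 := h.le_trans k1 k2
  have l2 := h.le_trans l1 (k3.trans' (by linarith))
  have l3 := h.le_trans l2 (k4.trans' (by linarith))
  have l4 := h.le_trans l3 (k5.trans' (by linarith))
  exact ⟨T, T, by have := le_max_left N 0; linarith⟩

/-- Limits for the Gromov distance are unique. -/
theorem HyperbolicWith.eq_of_tendsto_gromovDist {δ : ℝ} (h : HyperbolicWith X δ) (o : X)
    {x : ℕ → Boundary X} {y z : Boundary X}
    (hy : Tendsto (fun n => gromovDist o (x n) y) atTop (𝓝 0))
    (hz : Tendsto (fun n => gromovDist o (x n) z) atTop (𝓝 0)) : y = z := by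
  refine h.eq_of_gromovDist_lt o fun N _ => ?_
  obtain ⟨n, h1, h2⟩ := ((hy.eventually_lt_const (Real.exp_pos (-N))).and
    (hz.eventually_lt_const (Real.exp_pos (-N)))).exists
  exact ⟨x n, h1, h2⟩

/-! ### Convergence of sequences to boundary points -/

/-- The sequence `u` converges to the endpoint of the ray `a`. -/
def ConvergesTo (o : X) (u : ℕ → X) (a : GeodesicRay X) : Prop :=
  ∀ N : ℝ, ∃ (T : ℝ≥0) (n₀ : ℕ), ∀ n ≥ n₀, ∀ t ≥ T, N ≤ gromovProduct o (u n) (a.1 t)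

/-- A limit of the segments from `o` to `u n`, taken pointwise along a nonprincipal ultrafilter, in
place of Arzelà–Ascoli. The loss of `1` comes from replacing a point of the ray by a nearby point of
a segment. -/
theorem exists_ray_of_tendsto [ProperSpace X] (hgeod : IsGeodesicSpace X) (o : X) {u : ℕ → X}
    (hu : Tendsto (fun n => dist o (u n)) atTop atTop) :
    ∃ a : GeodesicRay X, ∀ (t : ℝ≥0) (n₀ : ℕ), ∃ n ≥ n₀, (t : ℝ) - 1 ≤
      gromovProduct o (a.1 t) (u n) := by
  choose c hc0 hc1 hc using fun n => hgeod o (u n)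
  have hU : (hyperfilter ℕ : Filter ℕ) ≤ atTop := Nat.hyperfilter_le_atTop
  have hev : ∀ t : ℝ≥0, ∀ᶠ n in (hyperfilter ℕ : Filter ℕ), (t : ℝ) ≤ dist o (u n) := fun t =>
    (hu.eventually_ge_atTop _).filter_mono hU
  have hlim : ∀ t : ℝ≥0, ∃ y : X, Tendsto (fun n => c n t) (hyperfilter ℕ : Filter ℕ) (𝓝 y) := by
    intro t
    obtain ⟨y, -, hy⟩ := isCompact_iff_ultrafilter_le_nhds.1 (isCompact_closedBall o (t : ℝ))
      ((hyperfilter ℕ).map fun n => c n t) (by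
        rw [le_principal_iff, Ultrafilter.coe_map, mem_map]
        filter_upwards [hev t] with n hn
        have := hc n t ⟨t.2, hn⟩ 0 ⟨le_rfl, dist_nonneg⟩
        rw [hc0, sub_zero, abs_of_nonneg t.coe_nonneg] at this
        exact this.le)
    exact ⟨y, hy⟩
  choose a ha using hlim
  have hiso : Isometry a := by
    refine Isometry.of_dist_eq fun s t => ?_
    refine tendsto_nhds_unique ((ha s).dist (ha t)) (tendsto_const_nhds.congr' ?_)
    filter_upwards [hev s, hev t] with n hs ht
    rw [hc n s ⟨s.2, hs⟩ t ⟨t.2, ht⟩, NNReal.dist_eq]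
  refine ⟨⟨a, hiso⟩, fun t n₀ => ?_⟩
  obtain ⟨n, h1, h2, h3⟩ := ((hev t).and (((eventually_ge_atTop n₀).filter_mono hU).and
    ((ha t).eventually (Metric.ball_mem_nhds _ one_pos)))).exists
  refine ⟨n, h2, ?_⟩
  have k1 := gromovProduct_le_add_dist_left o (c n t) (u n) (a t)
  have k2 : gromovProduct o (c n t) (u n) = t := by
    have e1 := hc n t ⟨t.2, h1⟩ 0 ⟨le_rfl, dist_nonneg⟩
    have e2 := hc n t ⟨t.2, h1⟩ _ ⟨dist_nonneg, le_rfl⟩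
    rw [hc0, sub_zero, abs_of_nonneg t.coe_nonneg] at e1
    rw [hc1, abs_sub_comm, abs_of_nonneg (sub_nonneg.2 h1)] at e2
    unfold gromovProduct
    rw [e1, e2, dist_comm (u n)]
    ring
  have h3' : dist (c n t) (a t) < 1 := h3
  show (t : ℝ) - 1 ≤ gromovProduct o (a t) (u n)
  linarith

theorem HyperbolicWith.exists_convergesTo [ProperSpace X] (hgeod : IsGeodesicSpace X) {δ : ℝ}
    (h : HyperbolicWith X δ) (o : X) {u : ℕ → X}
    (hu : ∀ N : ℝ, ∃ n₀, ∀ i ≥ n₀, ∀ j ≥ n₀, N ≤ gromovProduct o (u i) (u j)) :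
    ∃ a : GeodesicRay X, ConvergesTo o u a := by
  obtain ⟨a, ha⟩ := exists_ray_of_tendsto hgeod o (u := u) (tendsto_atTop.2 fun N => by
    obtain ⟨n₀, hn₀⟩ := hu N
    filter_upwards [eventually_ge_atTop n₀] with n hn
    rw [dist_comm]
    exact (hn₀ n hn n hn).trans (gromovProduct_le_dist_left _ _ _))
  refine ⟨a, fun N => ?_⟩
  obtain ⟨n₀, hn₀⟩ := hu (N + δ)
  refine ⟨Real.toNNReal (N + δ + 1), n₀, fun n hn t ht => ?_⟩
  have ht' : N + δ + 1 ≤ t := (Real.le_coe_toNNReal _).trans (NNReal.coe_le_coe.2 ht)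
  obtain ⟨m, hm, hm'⟩ := ha t n₀
  rw [gromovProduct_comm] at hm'
  have := h.le_trans (hn₀ n hn m hm) (z := a.1 t) (by linarith)
  linarith

theorem ConvergesTo.tendsto_dist {o : X} {u : ℕ → X} {a : GeodesicRay X}
    (hu : ConvergesTo o u a) : Tendsto (fun n => dist o (u n)) atTop atTop := by
  refine tendsto_atTop.2 fun N => ?_
  obtain ⟨T, n₀, hn⟩ := hu N
  filter_upwards [eventually_ge_atTop n₀] with n hn'
  rw [dist_comm]
  exact (hn n hn' T le_rfl).trans (gromovProduct_le_dist_left _ _ _)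

/-! ### Dynamics on the boundary -/

variable {Γ : Type*} [Group Γ] [MulAction Γ X] [IsIsometricSMul Γ X]

/-- The translate of a ray. -/
def GeodesicRay.translate (g : Γ) (a : GeodesicRay X) : GeodesicRay X :=
  ⟨fun t => g • a.1 t, (isometry_smul X g).comp a.2⟩

theorem gromovProduct_translate (g : Γ) (o x : X) :
    gromovProduct o (g • x) (g • o) = dist o (g • o) - gromovProduct o x (g⁻¹ • o) := by
  have h1 := gromovProduct_smul g (g⁻¹ • o) x o
  rw [smul_inv_smul] at h1
  have h2 := gromovProduct_add_swap o (g⁻¹ • o) x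
  have h3 := dist_smul g o (g⁻¹ • o)
  rw [smul_inv_smul, dist_comm] at h3
  rw [h1, h3, gromovProduct_comm o x, gromovProduct_comm _ x]
  linarith

/-- A ray `c` towards `x` has bounded product with `(γ ^ n)⁻¹ • o`. By `gromovProduct_translate`, `γ
^ n • c` then has product with `γ ^ n • o` tending to infinity, uniformly along the ray. -/
theorem HyperbolicWith.tendsto_pow_smul {δ : ℝ} (h : HyperbolicWith X δ) (o : X) {γ : Γ}
    {a b : GeodesicRay X} (ha : ConvergesTo o (fun n => γ ^ n • o) a)
    (hb : ConvergesTo o (fun n => (γ ^ n)⁻¹ • o) b) {x : Boundary X} (hx : x ≠ Boundary.mk b) :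
    Tendsto (fun n : ℕ => gromovDist o (γ ^ n • x) (Boundary.mk a)) atTop (𝓝 0) := by
  obtain ⟨c, rfl⟩ := x.exists_mk
  obtain ⟨M, hM⟩ := h.exists_forall_lt o hx
  obtain ⟨T, n₀, hT⟩ := hb (M + δ)
  have hc : ∀ n ≥ n₀, ∀ s, gromovProduct o (c.1 s) ((γ ^ n)⁻¹ • o) ≤ M + δ := by
    intro n hn s
    by_contra! hlt
    have := h.le_trans hlt.le (hT n hn T le_rfl)
    linarith [hM s T]
  refine tendsto_gromovDist_zero o fun N => ?_
  obtain ⟨S, n₁, hS⟩ := ha (N + δ)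
  filter_upwards [eventually_ge_atTop n₀, eventually_ge_atTop n₁,
    ha.tendsto_dist.eventually_ge_atTop (N + δ + (M + δ))] with n h0 h1 h2
  refine ⟨c.translate (γ ^ n), rfl, S, fun s _ t ht => ?_⟩
  have k1 : N + δ ≤ gromovProduct o ((c.translate (γ ^ n)).1 s) (γ ^ n • o) := by
    show N + δ ≤ gromovProduct o (γ ^ n • c.1 s) (γ ^ n • o)
    rw [gromovProduct_translate]
    linarith [hc n h0 s]
  have := h.le_trans k1 (hS n h1 t ht)
  linarith

theorem HyperbolicWith.smul_mk_eq {δ : ℝ} (h : HyperbolicWith X δ) (o : X) {γ : Γ}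
    {a : GeodesicRay X} (ha : ConvergesTo o (fun n => γ ^ n • o) a) :
    γ • Boundary.mk a = Boundary.mk a := by
  refine h.mk_eq_mk o fun N => ?_
  have hd : 0 ≤ dist o (γ • o) := dist_nonneg
  obtain ⟨T, n, hT⟩ := ha (N + δ + dist o (γ • o))
  refine ⟨T, T, ?_⟩
  have k1 := hT n le_rfl T le_rfl
  have k2 := hT (n + 1) n.le_succ T le_rfl
  simp only at k1 k2
  rw [gromovProduct_comm, ← gromovProduct_smul γ, smul_smul γ, ← pow_succ'] at k1
  have k3 := gromovProduct_le_add_dist_base (γ • o) o (γ • a.1 T) (γ ^ (n + 1) • o)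
  rw [dist_comm (γ • o)] at k3
  have : N + δ ≤ gromovProduct o ((a.translate γ).1 T) (γ ^ (n + 1) • o) := by
    show N + δ ≤ gromovProduct o (γ • a.1 T) (γ ^ (n + 1) • o)
    linarith
  have := h.le_trans this (z := a.1 T) (by linarith)
  rwa [add_sub_cancel_right] at this

/-- Rebasing at `γ ^ i • o` turns the bound `M` into almost additivity along the orbit. One far
orbit point then makes all later ones far, so mutual products tend to infinity. -/
theorem HyperbolicWith.exists_convergesTo_pow [ProperSpace X] [ProperlyDiscontinuousSMul Γ X]
    (hgeod : IsGeodesicSpace X) {δ : ℝ} (h : HyperbolicWith X δ) (o : X) {γ : Γ}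
    (hγ : ¬ IsOfFinOrder γ) {M : ℝ}
    (hM : ∀ m n : ℕ, gromovProduct o ((γ ^ m)⁻¹ • o) (γ ^ n • o) ≤ M) :
    ∃ a : GeodesicRay X, ConvergesTo o (fun n => γ ^ n • o) a := by
  have hadd : ∀ i j : ℕ, dist o (γ ^ i • o) - M ≤ gromovProduct o (γ ^ i • o) (γ ^ (i + j) • o) := by
    intro i j
    have h1 := gromovProduct_smul (γ ^ i) o ((γ ^ i)⁻¹ • o) (γ ^ j • o)
    rw [smul_inv_smul, smul_smul, ← pow_add] at h1
    have h2 := gromovProduct_add_swap o (γ ^ i • o) (γ ^ (i + j) • o)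
    linarith [hM i j]
  have hd : ∀ N : ℝ, ∃ n₀ : ℕ, ∀ n ≥ n₀, N ≤ dist o (γ ^ n • o) := by
    intro N
    obtain ⟨m, hm⟩ := exists_lt_dist_pow_smul o hγ (N + M)
    refine ⟨m, fun n hn => ?_⟩
    have h1 := hadd m (n - m)
    rw [Nat.add_sub_cancel' hn] at h1
    have h2 := gromovProduct_le_dist_right o (γ ^ m • o) (γ ^ n • o)
    rw [dist_comm]
    linarith
  refine h.exists_convergesTo hgeod o fun N => ?_
  obtain ⟨n₀, hn₀⟩ := hd (N + M)
  refine ⟨n₀, fun i hi j hj => ?_⟩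
  rcases le_total i j with hij | hij
  · have := hadd i (j - i)
    rw [Nat.add_sub_cancel' hij] at this
    linarith [hn₀ i hi]
  · have := hadd j (i - j)
    rw [Nat.add_sub_cancel' hij, gromovProduct_comm] at this
    linarith [hn₀ j hj]

/-- `γ` has north-south dynamics on the boundary, with attracting point `p` and repelling
point `q`. -/
structure NorthSouth (o : X) (γ : Γ) (p q : Boundary X) : Prop where
  ne : p ≠ q
  smul_attracting : γ • p = p
  smul_repelling : γ • q = q
  tendsto_attracting : ∀ x, x ≠ q → Tendsto (fun n : ℕ => gromovDist o (γ ^ n • x) p) atTop (𝓝 0)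
  tendsto_repelling : ∀ x, x ≠ p → Tendsto (fun n : ℕ => gromovDist o (γ⁻¹ ^ n • x) q) atTop (𝓝 0)

theorem NorthSouth.inv {o : X} {γ : Γ} {p q : Boundary X} (h : NorthSouth o γ p q) :
    NorthSouth o γ⁻¹ q p where
  ne := h.ne.symm
  smul_attracting := inv_smul_eq_iff.2 h.smul_repelling.symm
  smul_repelling := inv_smul_eq_iff.2 h.smul_attracting.symm
  tendsto_attracting := h.tendsto_repelling
  tendsto_repelling := by simpa using h.tendsto_attracting

theorem HyperbolicWith.exists_northSouth [ProperSpace X] [ProperlyDiscontinuousSMul Γ X]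
    (hgeod : IsGeodesicSpace X) {δ : ℝ} (h : HyperbolicWith X δ) (o : X)
    (hcocompact : ∃ K : Set X, IsCompact K ∧ ∀ x : X, ∃ γ : Γ, γ • x ∈ K)
    {γ : Γ} (hγ : ¬ IsOfFinOrder γ) : ∃ p q : Boundary X, NorthSouth o γ p q := by
  obtain ⟨M, hM⟩ := h.exists_gromovProduct_orbit_le hgeod o hcocompact hγ
  obtain ⟨a, ha⟩ := h.exists_convergesTo_pow hgeod o hγ hM
  obtain ⟨b, hb⟩ := h.exists_convergesTo_pow hgeod o (γ := γ⁻¹) (by rwa [isOfFinOrder_inv_iff])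
    (M := M) fun m n => by
      rw [inv_pow, inv_inv, inv_pow, gromovProduct_comm]
      exact hM n m
  have hb' : ConvergesTo o (fun n => (γ ^ n)⁻¹ • o) b := by simpa only [inv_pow] using hb
  have ha' : ConvergesTo o (fun n => (γ⁻¹ ^ n)⁻¹ • o) a := by
    simpa only [inv_pow, inv_inv] using ha
  refine ⟨Boundary.mk a, Boundary.mk b, ?_, h.smul_mk_eq o ha, ?_,
    fun x hx => h.tendsto_pow_smul o ha hb' hx, fun x hx => h.tendsto_pow_smul o hb ha' hx⟩
  · intro hab
    have hδ := h.nonneg o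
    obtain ⟨T1, hT1⟩ := exists_forall_le_gromovProduct_of_mk_eq o hab (M + 2 * δ + 1)
    obtain ⟨T2, n2, hT2⟩ := ha (M + 2 * δ + 1)
    obtain ⟨T3, n3, hT3⟩ := hb' (M + 2 * δ + 1)
    obtain ⟨T, h1, h2, h3⟩ : ∃ T, T1 ≤ T ∧ T2 ≤ T ∧ T3 ≤ T :=
      ⟨max T1 (max T2 T3), by simp, by simp, by simp⟩
    have k1 := hT1 T h1 T h1
    have k2 := hT2 n2 le_rfl T h2
    have k3 := hT3 n3 le_rfl T h3
    rw [gromovProduct_comm] at k1 k2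
    have l1 := h.le_trans k3 k1
    have l2 := h.le_trans l1 (k2.trans' (by linarith))
    linarith [hM n3 n2]
  · exact (inv_smul_eq_iff.1 (h.smul_mk_eq o hb)).symm

/-- The orbit of a pair of distinct boundary points accumulates at every boundary point. -/
theorem HyperbolicWith.exists_tendsto_orbit {δ : ℝ} (h : HyperbolicWith X δ) (o : X)
    (hcocompact : ∃ K : Set X, IsCompact K ∧ ∀ x : X, ∃ γ : Γ, γ • x ∈ K)
    {y₁ y₂ : Boundary X} (hy : y₁ ≠ y₂) (x : Boundary X) :
    ∃ (g : ℕ → Γ) (y : ℕ → Boundary X), (∀ n, y n = y₁ ∨ y n = y₂) ∧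
      Tendsto (fun n => gromovDist o (g n • y n) x) atTop (𝓝 0) := by
  obtain ⟨a, rfl⟩ := x.exists_mk
  obtain ⟨b₁, rfl⟩ := y₁.exists_mk
  obtain ⟨b₂, rfl⟩ := y₂.exists_mk
  obtain ⟨M, hM⟩ := h.exists_forall_lt o hy
  obtain ⟨R, hR⟩ := exists_dist_le_of_cocompact hcocompact o
  choose f hf using fun n : ℕ => hR (a.1 n)
  -- Distinct endpoints cannot both point towards `f n • o`. The ray that does not is sent by `(f
  -- n)⁻¹` close to `(f n)⁻¹ • o`, hence close to `a n`.
  have hc : ∀ n, ∃ c : GeodesicRay X, (c = b₁ ∨ c = b₂) ∧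
      ∀ s, gromovProduct o (c.1 s) (f n • o) ≤ M + δ := by
    intro n
    by_contra! hcon
    obtain ⟨s, hs⟩ := hcon b₁ (Or.inl rfl)
    obtain ⟨t, ht⟩ := hcon b₂ (Or.inr rfl)
    rw [gromovProduct_comm] at ht
    have := h.le_trans hs.le ht.le
    linarith [hM s t]
  choose c hc hcM using hc
  refine ⟨fun n => (f n)⁻¹, fun n => Boundary.mk (c n),
    fun n => (hc n).imp (congrArg _) (congrArg _), tendsto_gromovDist_zero o fun N => ?_⟩
  have hδ := h.nonneg o
  filter_upwards [tendsto_natCast_atTop_atTop.eventually_ge_atTop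
    (|N| + |M| + 2 * δ + |R| + dist o (a.1 0))] with n hn
  refine ⟨(c n).translate (f n)⁻¹, rfl, n, fun s _ t ht => ?_⟩
  have hfn : dist (a.1 n) ((f n)⁻¹ • o) ≤ R := by
    have := dist_smul (f n) (a.1 n) ((f n)⁻¹ • o)
    rw [smul_inv_smul] at this
    rw [← this]
    exact hf n
  have hd := a.le_dist o n
  have ht1 := dist_triangle (a.1 n) ((f n)⁻¹ • o) o
  rw [dist_comm ((f n)⁻¹ • o) o] at ht1
  have k1 : N + δ ≤ gromovProduct o ((f n)⁻¹ • (c n).1 s) ((f n)⁻¹ • o) := by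
    rw [gromovProduct_translate, inv_inv]
    have := hcM n s
    rw [NNReal.coe_natCast] at hd
    linarith [le_abs_self N, le_abs_self M, le_abs_self R]
  have k2 : N + δ ≤ gromovProduct o ((f n)⁻¹ • o) (a.1 t) := by
    have e1 := a.le_gromovProduct o (N := n) (s := n) (t := t) (by simp) (by
      rw [← NNReal.coe_natCast]; exact NNReal.coe_le_coe.2 ht)
    have e2 := gromovProduct_le_add_dist_left o (a.1 n) (a.1 t) ((f n)⁻¹ • o)
    linarith [le_abs_self N, abs_nonneg M, le_abs_self R]
  have k3 := h.le_trans k1 k2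
  rw [add_sub_cancel_right] at k3
  exact k3

end Rays

/-! ### Limits of subspaces -/

section Subspaces

variable {d : ℕ}

/-- The Euclidean orthogonal projection onto a subspace of `ℝ^d`. -/
def euclideanProj (V : Submodule ℝ (Fin d → ℝ)) (x : Fin d → ℝ) : Fin d → ℝ :=
  WithLp.ofLp ((V.map (WithLp.linearEquiv 2 ℝ (Fin d → ℝ)).symm.toLinearMap :
      Submodule ℝ (EuclideanSpace ℝ (Fin d))).starProjection (WithLp.toLp 2 x))

theorem euclideanProj_mem (V : Submodule ℝ (Fin d → ℝ)) (x : Fin d → ℝ) :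
    euclideanProj V x ∈ V := by
  obtain ⟨v, hv, hvx⟩ := Submodule.starProjection_apply_mem
    (V.map (WithLp.linearEquiv 2 ℝ (Fin d → ℝ)).symm.toLinearMap :
      Submodule ℝ (EuclideanSpace ℝ (Fin d))) (WithLp.toLp 2 x)
  have : euclideanProj V x = v := by
    unfold euclideanProj
    rw [← hvx]
    rfl
  rwa [this]

theorem euclideanProj_eq_self {V : Submodule ℝ (Fin d → ℝ)} {x : Fin d → ℝ} (hx : x ∈ V) :
    euclideanProj V x = x := by
  unfold euclideanProj
  have hm : (WithLp.toLp 2 x : EuclideanSpace ℝ (Fin d)) ∈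
      V.map (WithLp.linearEquiv 2 ℝ (Fin d → ℝ)).symm.toLinearMap := ⟨x, hx, rfl⟩
  rw [Submodule.starProjection_eq_self_iff.2 hm]

theorem tendsto_apply_of_norm_sub {E F : Type*} [NormedAddCommGroup E] [NormedSpace ℝ E]
    [NormedAddCommGroup F] [NormedSpace ℝ F] {T : ℕ → E →L[ℝ] F} {T' : E →L[ℝ] F}
    (h : Tendsto (fun n => ‖T n - T'‖) atTop (𝓝 0)) {x : ℕ → E} {y : E}
    (hx : Tendsto x atTop (𝓝 y)) : Tendsto (fun n => T n (x n)) atTop (𝓝 (T' y)) :=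
  ((isBoundedBilinearMap_apply (𝕜 := ℝ) (E := E) (F := F)).continuous.tendsto (T', y)).comp
    ((tendsto_iff_norm_sub_tendsto_zero.2 h).prodMk_nhds hx)

theorem tendsto_euclideanProj {V : ℕ → Submodule ℝ (Fin d → ℝ)} {W : Submodule ℝ (Fin d → ℝ)}
    (h : Tendsto (fun n => subspaceDist (V n) W) atTop (𝓝 0)) {x : ℕ → Fin d → ℝ}
    {y : Fin d → ℝ} (hx : Tendsto x atTop (𝓝 y)) :
    Tendsto (fun n => euclideanProj (V n) (x n)) atTop (𝓝 (euclideanProj W y)) := by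
  have hx' : Tendsto (fun n => (WithLp.toLp 2 (x n) : EuclideanSpace ℝ (Fin d))) atTop
      (𝓝 (WithLp.toLp 2 y)) := ((PiLp.continuous_toLp 2 fun _ : Fin d => ℝ).tendsto y).comp hx
  have h1 := tendsto_apply_of_norm_sub h hx'
  exact ((PiLp.continuous_ofLp 2 fun _ : Fin d => ℝ).tendsto _).comp h1

/-- For `v` in the limit `V'`, its projections to `V n` tend to `v` and are fixed by the projections
onto `W n`; in the limit `v` is fixed by the projection onto `W'`. -/
theorem le_of_tendsto_subspaceDist {V W : ℕ → Submodule ℝ (Fin d → ℝ)}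
    {V' W' : Submodule ℝ (Fin d → ℝ)}
    (hV : Tendsto (fun n => subspaceDist (V n) V') atTop (𝓝 0))
    (hW : Tendsto (fun n => subspaceDist (W n) W') atTop (𝓝 0)) (h : ∀ n, V n ≤ W n) :
    V' ≤ W' := by
  intro v hv
  have h1 := tendsto_euclideanProj hV (tendsto_const_nhds (x := v))
  rw [euclideanProj_eq_self hv] at h1
  have h2 := tendsto_euclideanProj hW h1
  have h3 := tendsto_nhds_unique h1
    (h2.congr fun n => euclideanProj_eq_self (h n (euclideanProj_mem _ _)))
  rw [h3]
  exact euclideanProj_mem _ _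

theorem eq_of_tendsto_subspaceDist {V : ℕ → Submodule ℝ (Fin d → ℝ)}
    {V' W' : Submodule ℝ (Fin d → ℝ)}
    (hV : Tendsto (fun n => subspaceDist (V n) V') atTop (𝓝 0))
    (hW : Tendsto (fun n => subspaceDist (V n) W') atTop (𝓝 0)) : V' = W' :=
  le_antisymm (le_of_tendsto_subspaceDist hV hW fun _ => le_rfl)
    (le_of_tendsto_subspaceDist hW hV fun _ => le_rfl)

theorem subspaceDist_self (V : Submodule ℝ (Fin d → ℝ)) : subspaceDist V V = 0 := by
  simp [subspaceDist]

/-- Normalized vectors on converging lines converge. -/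
theorem tendsto_of_tendsto_line {V : ℕ → Submodule ℝ (Fin d → ℝ)} {V' : Submodule ℝ (Fin d → ℝ)}
    (hV : Tendsto (fun n => subspaceDist (V n) V') atTop (𝓝 0)) (f : (Fin d → ℝ) →ₗ[ℝ] ℝ)
    {y : ℕ → Fin d → ℝ} {e : Fin d → ℝ} (hy : ∀ n, ∀ v ∈ V n, ∃ c : ℝ, v = c • y n)
    (hfy : ∀ n, f (y n) = 1) (he : e ∈ V') (hfe : f e = 1) : Tendsto y atTop (𝓝 e) := by
  have h1 := tendsto_euclideanProj hV (tendsto_const_nhds (x := e))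
  rw [euclideanProj_eq_self he] at h1
  have h2 : Tendsto (fun n => f (euclideanProj (V n) e)) atTop (𝓝 1) := by
    rw [← hfe]
    exact (f.continuous_of_finiteDimensional.tendsto e).comp h1
  have h3 := (h2.inv₀ one_ne_zero).smul h1
  rw [inv_one, one_smul] at h3
  refine h3.congr' ?_
  filter_upwards [h2.eventually_ne one_ne_zero] with n hn
  obtain ⟨c, hc⟩ := hy n _ (euclideanProj_mem (V n) e)
  rw [hc, map_smul, hfy, smul_eq_mul, mul_one] at hn ⊢
  rw [smul_smul, inv_mul_cancel₀ hn, one_smul]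

end Subspaces

/-! ### Dominant eigenvalues -/

section Dominant

/-- Consecutive differences tend to zero, but for `‖τ‖ ≥ 1` they are no smaller than `(τ - 1) • z`.
-/
theorem norm_lt_one_of_tendsto_pow_smul {E : Type*} [NormedAddCommGroup E] [NormedSpace ℂ E]
    {τ : ℂ} (hτ : τ ≠ 1) {z y : E} (hz : z ≠ 0)
    (h : Tendsto (fun n : ℕ => τ ^ n • z) atTop (𝓝 y)) : ‖τ‖ < 1 := by
  by_contra! hge
  have h1 := ((h.comp (tendsto_add_atTop_nat 1)).sub h).norm
  rw [sub_self, norm_zero] at h1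
  have h2 : ‖(τ - 1) • z‖ ≤ 0 := by
    refine ge_of_tendsto' h1 fun n => ?_
    have : ((fun n : ℕ => τ ^ n • z) ∘ fun n => n + 1) n - τ ^ n • z = τ ^ n • (τ - 1) • z := by
      simp only [Function.comp, pow_succ, smul_smul, ← sub_smul]
      ring_nf
    rw [this, norm_smul (τ ^ n), norm_pow]
    exact le_mul_of_one_le_left (norm_nonneg _) (one_le_pow₀ hge)
  exact (smul_ne_zero (sub_ne_zero.2 hτ) hz) (norm_le_zero_iff.1 h2)

/-- An operator whose normalized powers converge to a rank one operator has a simple dominant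
eigenvalue. -/
theorem dominant_of_tendsto {E : Type*} [NormedAddCommGroup E] [NormedSpace ℂ E]
    (T : Module.End ℂ E) {a : ℂ} (ha : a ≠ 0) {e : E} (he : e ≠ 0) (hTe : T e = a • e)
    (F : E → ℂ) (hF : ∀ z, Tendsto (fun n : ℕ => a⁻¹ ^ n • (T ^ n) z) atTop (𝓝 (F z • e))) :
    T.HasEigenvalue a ∧ (∀ ν : ℂ, T.HasEigenvalue ν → ν ≠ a → ‖ν‖ < ‖a‖) ∧
      Module.finrank ℂ (T.maxGenEigenspace a) = 1 := by
  have hpow : ∀ {ν : ℂ} {z : E}, T z = ν • z → ∀ n : ℕ, (T ^ n) z = ν ^ n • z := by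
    intro ν z hz n
    induction n with
    | zero => simp
    | succ n ih => rw [pow_succ, Module.End.mul_apply, hz, map_smul, ih, smul_smul, pow_succ']
  refine ⟨Module.End.hasEigenvalue_of_hasEigenvector
    (Module.End.hasEigenvector_iff.2 ⟨Module.End.mem_eigenspace_iff.2 hTe, he⟩), ?_, ?_⟩
  · intro ν hν hne
    obtain ⟨z, hz⟩ := hν.exists_hasEigenvector
    have hlim := hF z
    simp only [hpow hz.apply_eq_smul, smul_smul, ← mul_pow] at hlim
    have h1 := norm_lt_one_of_tendsto_pow_smul
      (by rwa [ne_eq, inv_mul_eq_one₀ ha, eq_comm]) hz.2 hlim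
    rwa [norm_mul, norm_inv, inv_mul_lt_one₀ (norm_pos_iff.2 ha)] at h1
  · have key : ∀ (k : ℕ) (z : E), ((T - a • (1 : Module.End ℂ E)) ^ k) z = 0 →
        z ∈ Submodule.span ℂ {e} := by
      intro k
      induction k with
      | zero => intro z hz; simp only [pow_zero, Module.End.one_apply] at hz; simp [hz]
      | succ k ih =>
        intro z hz
        rw [pow_succ, Module.End.mul_apply] at hz
        obtain ⟨c, hc⟩ := Submodule.mem_span_singleton.1 (ih _ hz)
        have hTz : T z = a • z + c • e := by
          rw [hc]
          simp
        -- A nontrivial Jordan block would show up as linear growth in `n`; convergence forces `c =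
        -- 0`.
        have hTn : ∀ n : ℕ, a⁻¹ ^ n • (T ^ n) z = z + ((n : ℂ) * (a⁻¹ * c)) • e := by
          intro n
          induction n with
          | zero => simp
          | succ n ihn =>
            rw [pow_succ', pow_succ', Module.End.mul_apply, ← smul_smul, ← map_smul, ihn, map_add,
              map_smul, hTe, hTz]
            simp only [smul_add, smul_smul]
            rw [inv_mul_cancel₀ ha, one_smul, add_assoc, ← add_smul]
            congr 2
            push_cast
            field_simp
            ring
        have hlim := hF z
        simp only [hTn] at hlim
        have h1 := (hlim.comp (tendsto_add_atTop_nat 1)).sub hlim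
        rw [sub_self] at h1
        have h2 : (a⁻¹ * c) • e = 0 := by
          refine tendsto_nhds_unique (tendsto_const_nhds.congr fun n => ?_) h1
          simp only [Function.comp, add_sub_add_left_eq_sub, ← sub_smul]
          congr 1
          push_cast
          ring
        have hc0 : a⁻¹ * c = 0 := (smul_eq_zero.1 h2).resolve_right he
        rw [hc0] at hlim
        simp only [mul_zero, zero_smul, add_zero] at hlim
        rw [tendsto_nhds_unique tendsto_const_nhds hlim]
        exact Submodule.smul_mem _ _ (Submodule.mem_span_singleton_self e)
    have hspan : T.maxGenEigenspace a = Submodule.span ℂ {e} := by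
      refine le_antisymm (fun z hz => ?_) ?_
      · obtain ⟨k, hk⟩ := (Module.End.mem_maxGenEigenspace T a z).1 hz
        exact key k z hk
      · rw [Submodule.span_singleton_le_iff_mem, Module.End.mem_maxGenEigenspace]
        exact ⟨1, by simp [hTe]⟩
    rw [hspan, finrank_span_singleton he]

variable {d : ℕ}

/-- The normalized powers of `A` converge to the rank one projection `v ↦ f v • e`. -/
structure IsContracting (A : Matrix (Fin d) (Fin d) ℝ) (a : ℝ) (e : Fin d → ℝ)
    (f : (Fin d → ℝ) →ₗ[ℝ] ℝ) : Prop where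
  ne_zero : a ≠ 0
  map_eq_one : f e = 1
  apply_eq : Matrix.toLin' A e = a • e
  map_apply : ∀ v, f (Matrix.toLin' A v) = a * f v
  tendsto : ∀ v, Tendsto (fun n : ℕ => a⁻¹ ^ n • (Matrix.toLin' A ^ n) v) atTop (𝓝 (f v • e))

/-! ### Eigenvalue, determinant and kernel of a contracting matrix -/

namespace IsContracting

variable {A : Matrix (Fin d) (Fin d) ℝ} {a : ℝ} {e : Fin d → ℝ} {f : (Fin d → ℝ) →ₗ[ℝ] ℝ}

theorem vector_ne_zero (h : IsContracting A a e f) : e ≠ 0 := by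
  rintro rfl
  simpa using h.map_eq_one

theorem eq_smul_of_apply_eq (h : IsContracting A a e f) {v : Fin d → ℝ}
    (hv : Matrix.toLin' A v = a • v) : v = f v • e := by
  have hpow : ∀ n : ℕ, (Matrix.toLin' A ^ n) v = a ^ n • v := by
    intro n
    induction n with
    | zero => simp
    | succ n ih => rw [pow_succ, Module.End.mul_apply, hv, map_smul, ih, smul_smul, pow_succ']
  have := h.tendsto v
  simp only [hpow, smul_smul, ← mul_pow, inv_mul_cancel₀ h.ne_zero, one_pow, one_smul] at this
  exact tendsto_nhds_unique tendsto_const_nhds this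

theorem eigenspace_eq (h : IsContracting A a e f) :
    Module.End.eigenspace (Matrix.toLin' A) a = Submodule.span ℝ {e} := by
  refine le_antisymm (fun v hv => ?_) ?_
  · rw [h.eq_smul_of_apply_eq (Module.End.mem_eigenspace_iff.1 hv)]
    exact Submodule.smul_mem _ _ (Submodule.mem_span_singleton_self e)
  · rw [Submodule.span_singleton_le_iff_mem, Module.End.mem_eigenspace_iff]
    exact h.apply_eq

theorem isDominantEigenvalue (h : IsContracting A a e f) : IsDominantEigenvalue A (a : ℂ) := by
  set T := Matrix.toLin' (A.map Complex.ofReal) with hT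
  have hreal : ∀ v : Fin d → ℝ, T (Complex.ofReal ∘ v) = Complex.ofReal ∘ Matrix.toLin' A v := by
    intro v
    ext i
    simp [hT, Matrix.mulVec, dotProduct]
  have hpow : ∀ (n : ℕ) (v : Fin d → ℝ),
      (T ^ n) (Complex.ofReal ∘ v) = Complex.ofReal ∘ (Matrix.toLin' A ^ n) v := by
    intro n
    induction n with
    | zero => intro v; rfl
    | succ n ih => intro v; rw [pow_succ, Module.End.mul_apply, hreal, ih]; rfl
  have hlim : ∀ v : Fin d → ℝ, Tendsto (fun n : ℕ => (a : ℂ)⁻¹ ^ n • (T ^ n) (Complex.ofReal ∘ v))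
      atTop (𝓝 ((f v : ℂ) • (Complex.ofReal ∘ e))) := by
    intro v
    have hcont : Continuous fun w : Fin d → ℝ => (Complex.ofReal ∘ w : Fin d → ℂ) := by
      fun_prop
    have h1 := (hcont.tendsto _).comp (h.tendsto v)
    have h2 : ∀ (r : ℝ) (w : Fin d → ℝ),
        (Complex.ofReal ∘ (r • w) : Fin d → ℂ) = (r : ℂ) • (Complex.ofReal ∘ w) := by
      intro r w
      ext i
      simp
    rw [h2] at h1
    refine h1.congr fun n => ?_
    show (Complex.ofReal ∘ (a⁻¹ ^ n • (Matrix.toLin' A ^ n) v) : Fin d → ℂ) = _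
    rw [h2, hpow]
    push_cast
    rfl
  refine dominant_of_tendsto T (Complex.ofReal_ne_zero.2 h.ne_zero) (e := Complex.ofReal ∘ e)
    ?_ ?_ (fun z => (f fun i => (z i).re) + Complex.I * (f fun i => (z i).im)) ?_
  · intro h0
    refine h.vector_ne_zero (funext fun i => ?_)
    simpa using congrFun h0 i
  · rw [hreal, h.apply_eq]
    ext i
    simp
  · intro z
    have hz : z = (Complex.ofReal ∘ fun i => (z i).re) +
        Complex.I • (Complex.ofReal ∘ fun i => (z i).im) := by
      ext i
      simp only [Pi.add_apply, Pi.smul_apply, Function.comp, smul_eq_mul]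
      rw [mul_comm, Complex.re_add_im]
    have h1 := (hlim fun i => (z i).re).add ((hlim fun i => (z i).im).const_smul Complex.I)
    rw [smul_smul, ← add_smul] at h1
    refine h1.congr fun n => ?_
    conv_rhs => rw [hz]
    rw [map_add, map_smul, smul_add, smul_comm Complex.I]

/-- The powers of `a⁻¹ • A` tend to a matrix that kills `w`, so the powers of its determinant tend
to zero. -/
theorem abs_det_lt (h : IsContracting A a e f) {w : Fin d → ℝ} (hw : w ≠ 0) (hfw : f w = 0) :
    |A.det| < |a| ^ d := by
  have hmat : Tendsto (fun n : ℕ => (a⁻¹ • A) ^ n) atTop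
      (𝓝 (Matrix.of fun i j => f (Pi.single j 1) * e i)) := by
    refine tendsto_pi_nhds.2 fun i => tendsto_pi_nhds.2 fun j => ?_
    have h1 := tendsto_pi_nhds.1 (h.tendsto (Pi.single j 1)) i
    refine h1.congr fun n => ?_
    rw [smul_pow, ← Matrix.toLin'_pow, Matrix.toLin'_apply, Matrix.mulVec_single_one]
    rfl
  have hdet := ((Continuous.matrix_det continuous_id).tendsto _).comp hmat
  have hzero : (Matrix.of fun i j => f (Pi.single j 1) * e i).det = 0 := by
    refine Matrix.exists_mulVec_eq_zero_iff.1 ⟨w, hw, ?_⟩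
    ext i
    have : f w = ∑ j, w j * f (Pi.single j 1) := by
      conv_lhs => rw [pi_eq_sum_univ' w]
      simp
    simp only [Matrix.mulVec, dotProduct, Matrix.of_apply, Pi.zero_apply]
    calc ∑ j, f (Pi.single j 1) * e i * w j = (∑ j, w j * f (Pi.single j 1)) * e i := by
          rw [Finset.sum_mul]
          exact Finset.sum_congr rfl fun j _ => by ring
      _ = 0 := by rw [← this, hfw, zero_mul]
  simp only [id] at hdet
  rw [hzero] at hdet
  have h2 : Tendsto (fun n : ℕ => (a⁻¹ • A).det ^ n) atTop (𝓝 0) :=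
    hdet.congr fun n => by simp [Function.comp, Matrix.det_pow]
  rw [tendsto_pow_atTop_nhds_zero_iff, Matrix.det_smul, Fintype.card_fin, abs_mul, abs_pow,
    abs_inv, inv_pow, inv_mul_lt_one₀ (pow_pos (abs_pos.2 h.ne_zero) d)] at h2
  exact h2

/-- The eigenvector contracted to by the inverse lies in the complementary hyperplane. -/
theorem map_inverse_eq_zero {B : GL (Fin d) ℝ} {b : ℝ} {e' : Fin d → ℝ}
    {f' : (Fin d → ℝ) →ₗ[ℝ] ℝ} (h : IsContracting (B : Matrix (Fin d) (Fin d) ℝ) a e f)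
    (h' : IsContracting ((B⁻¹ : GL (Fin d) ℝ) : Matrix (Fin d) (Fin d) ℝ) b e' f')
    {w w' : Fin d → ℝ} (hw : w ≠ 0) (hfw : f w = 0) (hw' : w' ≠ 0) (hfw' : f' w' = 0) :
    f e' = 0 := by
  by_contra hne
  have h1 := h.abs_det_lt hw hfw
  have h2 := h'.abs_det_lt hw' hfw'
  have hBe : Matrix.toLin' (B : Matrix (Fin d) (Fin d) ℝ) (b • e') = e' := by
    rw [← h'.apply_eq, Matrix.toLin'_apply, Matrix.toLin'_apply, Matrix.mulVec_mulVec,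
      ← Units.val_mul, mul_inv_cancel]
    simp
  -- `f` is a left eigenvector of `B` for `a`, and `e'` is an eigenvector of `B` for `b⁻¹`; if `f e'
  -- ≠ 0` the two eigenvalues agree.
  have hab : a * b = 1 := by
    have := h.map_apply (b • e')
    rw [hBe, map_smul, smul_eq_mul, ← mul_assoc] at this
    exact mul_right_cancel₀ hne (by rw [← this, one_mul])
  have h3 : |(B : Matrix (Fin d) (Fin d) ℝ).det| *
      |((B⁻¹ : GL (Fin d) ℝ) : Matrix (Fin d) (Fin d) ℝ).det| = 1 := by
    rw [← abs_mul, ← Matrix.det_mul, ← Units.val_mul, mul_inv_cancel]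
    simp
  have h4 : |a| ^ d * |b| ^ d = 1 := by rw [← mul_pow, ← abs_mul, hab, abs_one, one_pow]
  have h5 := mul_lt_mul'' h1 h2 (abs_nonneg _) (abs_nonneg _)
  rw [h3, h4] at h5
  exact lt_irrefl _ h5

theorem eigenvalue_unique {a' : ℝ} {e' : Fin d → ℝ} {f' : (Fin d → ℝ) →ₗ[ℝ] ℝ}
    (h : IsContracting A a e f) (h' : IsContracting A a' e' f') : a = a' := by
  by_contra hne
  have h1 := h.isDominantEigenvalue.2.1 _ h'.isDominantEigenvalue.1
    fun h => hne (Complex.ofReal_injective h).symm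
  have h2 := h'.isDominantEigenvalue.2.1 _ h.isDominantEigenvalue.1
    fun h => hne (Complex.ofReal_injective h)
  exact lt_asymm h1 h2

/-- The kernel of `f` consists of the vectors whose normalized powers tend to zero, and the
normalizing eigenvalue is determined by `A`. -/
theorem ker_le {a' : ℝ} {e' : Fin d → ℝ} {f' : (Fin d → ℝ) →ₗ[ℝ] ℝ}
    (h : IsContracting A a e f) (h' : IsContracting A a' e' f') :
    LinearMap.ker f ≤ LinearMap.ker f' := by
  obtain rfl := h.eigenvalue_unique h'
  intro v hv
  have := tendsto_nhds_unique (h.tendsto v) (h'.tendsto v)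
  rw [LinearMap.mem_ker.1 hv, zero_smul, eq_comm, smul_eq_zero] at this
  exact LinearMap.mem_ker.2 (this.resolve_right h'.vector_ne_zero)

end IsContracting

end Dominant

/-! ### Convex pairs -/

section ConvexPairs

variable {X : Type*} [MetricSpace X] {d : ℕ}

theorem IsHolder.tendsto {o : X} {f : Boundary X → Submodule ℝ (Fin d → ℝ)} (hf : IsHolder o f)
    {x : ℕ → Boundary X} {y : Boundary X}
    (h : Tendsto (fun n => gromovDist o (x n) y) atTop (𝓝 0)) :
    Tendsto (fun n => subspaceDist (f (x n)) (f y)) atTop (𝓝 0) := by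
  obtain ⟨C, r, hr, hC⟩ := hf
  have h1 := (h.rpow_const (Or.inr hr.le)).const_mul C
  rw [Real.zero_rpow hr.ne', mul_zero] at h1
  exact squeeze_zero (fun _ => norm_nonneg _) (fun n => hC _ _) h1

theorem mapSubspace_of_mk_eq {A : GL (Fin d) ℝ} {g : Matrix.ProjGenLinGroup (Fin d) ℝ}
    (h : Matrix.ProjGenLinGroup.mk A = g) (W : Submodule ℝ (Fin d → ℝ)) :
    mapSubspace g W = W.map (Matrix.toLin' (A : Matrix (Fin d) (Fin d) ℝ)) := by
  rw [← h, mapSubspace_mk]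
  rfl

theorem mk_lift (g : Matrix.ProjGenLinGroup (Fin d) ℝ) :
    Matrix.ProjGenLinGroup.mk (lift g) = g :=
  Function.surjInv_eq _ _

variable {Γ : Type*} [Group Γ] {ρ : Γ →* Matrix.ProjGenLinGroup (Fin d) ℝ}

theorem IsIrreducible.not_invariant_line (hirr : IsIrreducible ρ) (hd : 2 ≤ d)
    (ℓ : ℙ ℝ (Fin d → ℝ)) : ¬ ∀ γ : Γ, mapSubspace (ρ γ) ℓ.submodule ≤ ℓ.submodule := by
  intro h
  have h1 := ℓ.finrank_submodule
  rcases hirr.2 _ h with h0 | h0 <;> rw [h0] at h1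
  · simp at h1
  · rw [finrank_top, Module.finrank_fin_fun] at h1
    omega

theorem IsIrreducible.exists_ne_one (hirr : IsIrreducible ρ) (hd : 2 ≤ d) : ∃ γ : Γ, γ ≠ 1 := by
  by_contra! hall
  have hv : (Pi.single ⟨0, by omega⟩ 1 : Fin d → ℝ) ≠ 0 := by simp
  refine hirr.not_invariant_line hd (Projectivization.mk ℝ _ hv) fun γ => ?_
  rw [mapSubspace_of_mk_eq (A := 1) (by rw [hall γ, map_one, map_one])]
  simp

variable [MulAction Γ X] [IsIsometricSMul Γ X] {o : X}
  {ξ : Boundary X → ℙ ℝ (Fin d → ℝ)} {η : Boundary X → Hyperplane d}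

/-! ### Dynamics of `ρ γ` read off from a convex pair -/

namespace IsConvexPair

theorem pow_smul_line (h : IsConvexPair o ρ ξ η) {γ : Γ} {A : GL (Fin d) ℝ}
    (hA : Matrix.ProjGenLinGroup.mk A = ρ γ) (x : Boundary X) (n : ℕ) :
    (ξ (γ ^ n • x)).submodule =
      (ξ x).submodule.map (Matrix.toLin' (A : Matrix (Fin d) (Fin d) ℝ) ^ n) := by
  induction n with
  | zero => simp only [pow_zero, one_smul]; exact (Submodule.map_id _).symm
  | succ n ih =>
    rw [pow_succ', ← smul_smul, h.equivariant_line, mapSubspace_of_mk_eq hA, ih,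
      ← Submodule.map_comp, pow_succ']
    rfl

theorem eq_top_of_forall_line_le (h : IsConvexPair o ρ ξ η) (hirr : IsIrreducible ρ)
    (p : Boundary X) {S : Submodule ℝ (Fin d → ℝ)} (hS : ∀ x, (ξ x).submodule ≤ S) : S = ⊤ := by
  have hinv : ∀ γ : Γ, mapSubspace (ρ γ) (⨆ x, (ξ x).submodule) ≤ ⨆ x, (ξ x).submodule := by
    intro γ
    rw [mapSubspace, Submodule.map_iSup]
    refine iSup_le fun x => ?_
    have := h.equivariant_line γ x
    rw [mapSubspace] at this
    rw [← this]
    exact le_iSup (fun x => (ξ x).submodule) (γ • x)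
  rcases hirr.2 _ hinv with h0 | h0
  · have h1 := (ξ p).finrank_submodule
    have h2 := le_iSup (fun x => (ξ x).submodule) p
    rw [h0, le_bot_iff] at h2
    rw [h2] at h1
    simp at h1
  · exact top_le_iff.1 (h0 ▸ iSup_le hS)

/-- Dropping `q` costs nothing: `ξ q` is the limit of the lines at `γ⁻¹ ^ n • x`, and these points
avoid the fixed point `q`. This is where a third boundary point enters. -/
theorem eq_top_of_forall_ne_line_le (h : IsConvexPair o ρ ξ η) (hirr : IsIrreducible ρ) {γ : Γ}
    {p q x : Boundary X} (hγ : NorthSouth o γ p q) (hxp : x ≠ p) (hxq : x ≠ q)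
    {S : Submodule ℝ (Fin d → ℝ)} (hS : ∀ y, y ≠ q → (ξ y).submodule ≤ S) : S = ⊤ := by
  refine h.eq_top_of_forall_line_le hirr p fun y => ?_
  by_cases hy : y = q
  · subst hy
    refine le_of_tendsto_subspaceDist (h.holder_line.tendsto (hγ.tendsto_repelling x hxp))
      (W := fun _ => S) (by simp [subspaceDist_self]) fun n => hS _ fun hn => hxq ?_
    have hfix : ∀ n : ℕ, γ⁻¹ ^ n • y = y := by
      intro n
      induction n with
      | zero => simp
      | succ n ih => rw [pow_succ', ← smul_smul, ih, hγ.inv.smul_attracting]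
    exact smul_left_cancel _ (hn.trans (hfix n).symm)
  · exact hS y hy

/-- The dynamics of `ρ γ` on vectors. -/
theorem exists_isContracting (h : IsConvexPair o ρ ξ η) (hirr : IsIrreducible ρ) {γ : Γ}
    {p q x : Boundary X} (hγ : NorthSouth o γ p q) (hxp : x ≠ p) (hxq : x ≠ q)
    {A : GL (Fin d) ℝ} (hA : Matrix.ProjGenLinGroup.mk A = ρ γ) :
    ∃ (a : ℝ) (e : Fin d → ℝ) (f : (Fin d → ℝ) →ₗ[ℝ] ℝ),
      IsContracting (A : Matrix (Fin d) (Fin d) ℝ) a e f ∧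
      (ξ p).submodule = Submodule.span ℝ {e} ∧ LinearMap.ker f = (η q).1 := by
  set T := Matrix.toLin' (A : Matrix (Fin d) (Fin d) ℝ) with hT
  have hcompl := h.transverse p q hγ.ne
  set e₀ := (ξ p).rep
  have he₀ : (ξ p).submodule = Submodule.span ℝ {e₀} := Projectivization.submodule_eq _
  have he₀mem : e₀ ∈ (ξ p).submodule := he₀ ▸ Submodule.mem_span_singleton_self _
  have hnot : e₀ ∉ (η q).1 := fun hmem =>
    (ξ p).rep_nonzero (Submodule.disjoint_def.1 hcompl.disjoint _ he₀mem hmem)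
  obtain ⟨f₀, hf₀, hle⟩ := Submodule.exists_le_ker_of_notMem hnot
  obtain ⟨f, hf⟩ : ∃ f : (Fin d → ℝ) →ₗ[ℝ] ℝ, f = (f₀ e₀)⁻¹ • f₀ := ⟨_, rfl⟩
  have hfe : f e₀ = 1 := by rw [hf, LinearMap.smul_apply, smul_eq_mul, inv_mul_cancel₀ hf₀]
  have hfW : ∀ w ∈ (η q).1, f w = 0 := fun w hw => by
    rw [hf, LinearMap.smul_apply, LinearMap.mem_ker.1 (hle hw), smul_zero]
  have hdec : ∀ v, ∃ w ∈ (η q).1, v = f v • e₀ + w := by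
    intro v
    have hv : v ∈ (ξ p).submodule ⊔ (η q).1 := by rw [hcompl.sup_eq_top]; trivial
    obtain ⟨u, hu, w, hw, rfl⟩ := Submodule.mem_sup.1 hv
    rw [he₀] at hu
    obtain ⟨c, rfl⟩ := Submodule.mem_span_singleton.1 hu
    exact ⟨w, hw, by rw [map_add, map_smul, hfe, hfW w hw]; simp⟩
  have hker : LinearMap.ker f = (η q).1 := by
    refine le_antisymm (fun v hv => ?_) fun w hw => LinearMap.mem_ker.2 (hfW w hw)
    obtain ⟨w, hw, hvw⟩ := hdec v
    rw [LinearMap.mem_ker.1 hv, zero_smul, zero_add] at hvw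
    rwa [hvw]
  have hinj : Function.Injective T := by
    intro u v huv
    have := congrArg (Matrix.toLin' ((A⁻¹ : GL (Fin d) ℝ) : Matrix (Fin d) (Fin d) ℝ)) huv
    simpa [hT, Matrix.toLin'_apply, Matrix.mulVec_mulVec, ← Units.val_mul] using this
  have hTe : ∃ a : ℝ, T e₀ = a • e₀ := by
    have h1 : T e₀ ∈ (ξ p).submodule := by
      rw [← hγ.smul_attracting, h.equivariant_line, mapSubspace_of_mk_eq hA]
      exact Submodule.mem_map_of_mem he₀mem
    rw [he₀] at h1
    obtain ⟨a, ha⟩ := Submodule.mem_span_singleton.1 h1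
    exact ⟨a, ha.symm⟩
  obtain ⟨a, ha⟩ := hTe
  have ha0 : a ≠ 0 := by
    rintro rfl
    rw [zero_smul, ← map_zero T] at ha
    exact (ξ p).rep_nonzero (hinj ha)
  have hTW : ∀ w ∈ (η q).1, T w ∈ (η q).1 := by
    intro w hw
    rw [← hγ.smul_repelling, h.equivariant_hyperplane, mapSubspace_of_mk_eq hA]
    exact Submodule.mem_map_of_mem hw
  have hfT : ∀ v, f (T v) = a * f v := by
    intro v
    obtain ⟨w, hw, hvw⟩ := hdec v
    conv_lhs => rw [hvw]
    rw [map_add, map_smul, ha, map_add, hfW _ (hTW w hw), map_smul, map_smul, hfe]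
    simp [mul_comm]
  have hfTn : ∀ (n : ℕ) v, f ((T ^ n) v) = a ^ n * f v := by
    intro n
    induction n with
    | zero => simp
    | succ n ih => intro v; rw [pow_succ', Module.End.mul_apply, hfT, ih, pow_succ', mul_assoc]
  -- The vectors with the desired limit form a subspace, so it suffices to treat the lines `ξ y`
  -- with `y ≠ q`.
  let S : Submodule ℝ (Fin d → ℝ) :=
    { carrier := {v | Tendsto (fun n : ℕ => a⁻¹ ^ n • (T ^ n) v) atTop (𝓝 (f v • e₀))}
      zero_mem' := by simp
      add_mem' := fun {u v} hu hv => by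
        have := Filter.Tendsto.add (Set.mem_ofPred_eq ▸ hu) (Set.mem_ofPred_eq ▸ hv)
        simpa only [Set.mem_ofPred_eq, map_add, smul_add, add_smul] using this
      smul_mem' := fun c v hv => by
        have := Filter.Tendsto.const_smul (Set.mem_ofPred_eq ▸ hv) c
        simpa only [Set.mem_ofPred_eq, map_smul, smul_comm c, smul_assoc] using this }
  have hS : S = ⊤ := by
    refine h.eq_top_of_forall_ne_line_le hirr hγ hxp hxq fun y hy v hv => ?_
    show Tendsto (fun n : ℕ => a⁻¹ ^ n • (T ^ n) v) atTop (𝓝 (f v • e₀))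
    by_cases hv0 : v = 0
    · simp [hv0]
    -- Transversality of `ξ y` and `η q` lets `f` normalize vectors on the line; since `f ∘ T = a •
    -- f`, the normalization is exactly `a⁻¹ ^ n`.
    have hfv : f v ≠ 0 := fun h0 => hv0 <| by
      refine Submodule.disjoint_def.1 (h.transverse y q hy).disjoint _ hv ?_
      rw [← hker]
      exact LinearMap.mem_ker.2 h0
    have hspan : (ξ y).submodule = Submodule.span ℝ {v} := by
      symm
      refine Submodule.eq_of_le_of_finrank_eq ((Submodule.span_singleton_le_iff_mem _ _).2 hv) ?_
      rw [finrank_span_singleton hv0, (ξ y).finrank_submodule]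
    have hlim := tendsto_of_tendsto_line (h.holder_line.tendsto (hγ.tendsto_attracting y hy)) f
      (y := fun n => (f v)⁻¹ • a⁻¹ ^ n • (T ^ n) v) (e := e₀) ?_ ?_ he₀mem hfe
    · have h1 := hlim.const_smul (f v)
      simpa only [smul_inv_smul₀ hfv] using h1
    · intro n w hw
      rw [h.pow_smul_line hA, hspan, Submodule.map_span, Set.image_singleton] at hw
      obtain ⟨c, rfl⟩ := Submodule.mem_span_singleton.1 hw
      refine ⟨c * a ^ n * f v, ?_⟩
      rw [smul_smul, smul_smul]
      congr 1
      rw [inv_pow]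
      field_simp
    · intro n
      rw [map_smul, map_smul, hfTn, smul_eq_mul, smul_eq_mul, inv_pow]
      field_simp
  refine ⟨a, e₀, f, ⟨ha0, hfe, ha, hfT, fun v => ?_⟩, he₀, hker⟩
  have : v ∈ S := hS ▸ Submodule.mem_top
  exact this

theorem exists_ne_zero_mem_hyperplane (hd : 2 ≤ d) (W : Hyperplane d) : ∃ w ∈ W.1, w ≠ 0 := by
  refine Submodule.exists_mem_ne_zero_of_ne_bot fun h0 => ?_
  have := W.2
  rw [h0, finrank_bot] at this
  omega

/-- `ξ q` is the attracting line of `ρ γ⁻¹`, so the determinant comparison for a matrix and its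
inverse applies. `2 ≤ d` supplies nonzero vectors in the hyperplanes. -/
theorem line_le_hyperplane_repelling (h : IsConvexPair o ρ ξ η) (hirr : IsIrreducible ρ)
    (hd : 2 ≤ d) {γ : Γ} {p q x : Boundary X} (hγ : NorthSouth o γ p q) (hxp : x ≠ p)
    (hxq : x ≠ q) : (ξ q).submodule ≤ (η q).1 := by
  obtain ⟨a, e, f, hf, -, hker⟩ := h.exists_isContracting hirr hγ hxp hxq (mk_lift (ρ γ))
  obtain ⟨b, e', f', hf', he', hker'⟩ := h.exists_isContracting hirr hγ.inv hxq hxp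
    (A := (lift (ρ γ))⁻¹) (by rw [map_inv, mk_lift, map_inv])
  obtain ⟨w, hw, hw0⟩ := exists_ne_zero_mem_hyperplane hd (η q)
  obtain ⟨w', hw', hw0'⟩ := exists_ne_zero_mem_hyperplane hd (η p)
  rw [← hker] at hw
  rw [← hker'] at hw'
  rw [he', ← hker, Submodule.span_singleton_le_iff_mem]
  exact hf.map_inverse_eq_zero hf' hw0 hw hw0' hw'

theorem isAttractingLine (h : IsConvexPair o ρ ξ η) (hirr : IsIrreducible ρ) {γ : Γ}
    {p q x : Boundary X} (hγ : NorthSouth o γ p q) (hxp : x ≠ p) (hxq : x ≠ q) :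
    IsAttractingLine (ρ γ) (ξ p) := by
  obtain ⟨a, e, f, hf, he, -⟩ := h.exists_isContracting hirr hγ hxp hxq (mk_lift (ρ γ))
  exact ⟨a, hf.isDominantEigenvalue, he.trans hf.eigenspace_eq.symm⟩

theorem eq_at_fixed_points {ξ' : Boundary X → ℙ ℝ (Fin d → ℝ)} {η' : Boundary X → Hyperplane d}
    (h : IsConvexPair o ρ ξ η) (h' : IsConvexPair o ρ ξ' η') (hirr : IsIrreducible ρ)
    {γ : Γ} {p q x : Boundary X} (hγ : NorthSouth o γ p q) (hxp : x ≠ p) (hxq : x ≠ q) :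
    ξ p = ξ' p ∧ η q = η' q := by
  obtain ⟨a, e, f, hf, he, hker⟩ := h.exists_isContracting hirr hγ hxp hxq (mk_lift (ρ γ))
  obtain ⟨a', e', f', hf', he', hker'⟩ :=
    h'.exists_isContracting hirr hγ hxp hxq (mk_lift (ρ γ))
  constructor
  · refine Projectivization.submodule_injective ?_
    rw [he, he', ← hf.eigenspace_eq, ← hf'.eigenspace_eq, hf.eigenvalue_unique hf']
  · refine Subtype.ext ?_
    rw [← hker, ← hker']
    exact le_antisymm (hf.ker_le hf') (hf'.ker_le hf)

end IsConvexPair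

/-- If `p` and `q` were the whole boundary, every nontrivial element would have them as its two
fixed points, so `ξ p` would be an invariant line. -/
theorem exists_third_point {γ : Γ} {p q : Boundary X} (h : IsConvexPair o ρ ξ η)
    (hirr : IsIrreducible ρ) (hd : 2 ≤ d)
    (hNS : ∀ γ : Γ, γ ≠ 1 → ∃ p q : Boundary X, NorthSouth o γ p q)
    (hγ : NorthSouth o γ p q) : ∃ x, x ≠ p ∧ x ≠ q := by
  by_contra! hcon
  have htwo : ∀ x, x = p ∨ x = q := fun x => or_iff_not_imp_left.2 (hcon x)
  refine hirr.not_invariant_line hd (ξ p) fun g => ?_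
  rw [← h.equivariant_line]
  suffices g • p = p by rw [this]
  by_cases hg : g = 1
  · rw [hg, one_smul]
  obtain ⟨p', q', hg'⟩ := hNS g hg
  rcases htwo p' with rfl | rfl
  · exact hg'.smul_attracting
  · rcases htwo q' with rfl | rfl
    · exact hg'.smul_repelling
    · exact absurd rfl hg'.ne

theorem NorthSouth.isAttractingFixedPoint {γ : Γ} {p q : Boundary X} (h : NorthSouth o γ p q) :
    IsAttractingFixedPoint o γ p :=
  ⟨h.smul_attracting, q, h.ne.symm, h.smul_repelling, h.tendsto_attracting⟩

/-- Uniqueness of limits, tested on `p` itself, or on the third point `x` when `p` is the repelling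
point attached to `p'`. -/
theorem NorthSouth.eq_of_isAttractingFixedPoint {δ : ℝ} (hhyp : HyperbolicWith X δ) {γ : Γ}
    {p q x p' : Boundary X} (h : NorthSouth o γ p q) (hxp : x ≠ p) (hxq : x ≠ q)
    (hp' : IsAttractingFixedPoint o γ p') : p' = p := by
  obtain ⟨-, q', hq', -, htend⟩ := hp'
  by_cases hpq : p = q'
  · exact hhyp.eq_of_tendsto_gromovDist o (htend x (hpq ▸ hxp)) (h.tendsto_attracting x hxq)
  · exact hhyp.eq_of_tendsto_gromovDist o (htend p hpq) (h.tendsto_attracting p h.ne)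

/-- A closed invariant property of two boundary points holds everywhere. -/
theorem HyperbolicWith.forall_boundary {δ : ℝ} (h : HyperbolicWith X δ) (o : X)
    (hcocompact : ∃ K : Set X, IsCompact K ∧ ∀ x : X, ∃ γ : Γ, γ • x ∈ K)
    {P : Boundary X → Prop} {p q : Boundary X} (hpq : p ≠ q) (hp : P p) (hq : P q)
    (hinv : ∀ (γ : Γ) x, P x → P (γ • x))
    (hclosed : ∀ (x : ℕ → Boundary X) (y : Boundary X), (∀ n, P (x n)) →
      Tendsto (fun n => gromovDist o (x n) y) atTop (𝓝 0) → P y) (x : Boundary X) : P x := by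
  obtain ⟨g, y, hy, hlim⟩ := h.exists_tendsto_orbit o hcocompact hpq x
  exact hclosed _ x (fun n => hinv _ _ ((hy n).elim (fun e => e ▸ hp) fun e => e ▸ hq)) hlim

end ConvexPairs

end ConvexRep

end

/-! ### The main theorem -/

theorem mainTheorem12 {X : Type*} [MetricSpace X] [ProperSpace X]
    (hgeod : ConvexRep.IsGeodesicSpace X) (hhyp : ConvexRep.IsGromovHyperbolic X) (o : X)
    {Γ : Type*} [Group Γ] [MulAction Γ X] [IsIsometricSMul Γ X]
    [ProperlyDiscontinuousSMul Γ X]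
    (hcocompact : ∃ K : Set X, IsCompact K ∧ ∀ x : X, ∃ γ : Γ, γ • x ∈ K)
    (htorsionfree : ∀ γ : Γ, γ ≠ 1 → ¬ IsOfFinOrder γ)
    {d : ℕ} (hd : 2 ≤ d) (ρ : Γ →* Matrix.ProjGenLinGroup (Fin d) ℝ)
    (hρ : ConvexRep.IsStrictlyConvex o ρ) :
    (∀ γ : Γ, γ ≠ 1 → ConvexRep.IsProximal (ρ γ) ∧
      ∃! p : ConvexRep.Boundary X, ConvexRep.IsAttractingFixedPoint o γ p) ∧
    (∀ (ξ : ConvexRep.Boundary X → ℙ ℝ (Fin d → ℝ))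
        (η : ConvexRep.Boundary X → ConvexRep.Hyperplane d), ConvexRep.IsConvexPair o ρ ξ η →
      (∀ γ : Γ, γ ≠ 1 → ∀ p : ConvexRep.Boundary X, ConvexRep.IsAttractingFixedPoint o γ p →
        ConvexRep.IsAttractingLine (ρ γ) (ξ p)) ∧
      ∀ x : ConvexRep.Boundary X, (ξ x).submodule ≤ (η x).1) ∧
    ∃! p : (ConvexRep.Boundary X → ℙ ℝ (Fin d → ℝ)) ×
        (ConvexRep.Boundary X → ConvexRep.Hyperplane d),
      ConvexRep.IsConvexPair o ρ p.1 p.2 := by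
  obtain ⟨δ, hδ⟩ : ∃ δ, ConvexRep.HyperbolicWith X δ := hhyp
  obtain ⟨hirr, ξ₀, η₀, h₀⟩ := hρ
  have hNS : ∀ γ : Γ, γ ≠ 1 → ∃ p q : ConvexRep.Boundary X, ConvexRep.NorthSouth o γ p q :=
    fun γ hγ => hδ.exists_northSouth hgeod o hcocompact (htorsionfree γ hγ)
  have hthird : ∀ {γ : Γ} {p q : ConvexRep.Boundary X}, ConvexRep.NorthSouth o γ p q →
      ∃ x, x ≠ p ∧ x ≠ q := fun h => ConvexRep.exists_third_point h₀ hirr hd hNS h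
  obtain ⟨g, hg⟩ := hirr.exists_ne_one hd
  obtain ⟨p, q, hpq⟩ := hNS g hg
  obtain ⟨x, hxp, hxq⟩ := hthird hpq
  refine ⟨fun γ hγ => ?_, fun ξ η h => ⟨fun γ hγ p' hp' => ?_, ?_⟩, (ξ₀, η₀), h₀, ?_⟩
  · obtain ⟨p, q, hpq⟩ := hNS γ hγ
    obtain ⟨x, hxp, hxq⟩ := hthird hpq
    obtain ⟨a, ha, -⟩ := h₀.isAttractingLine hirr hpq hxp hxq
    exact ⟨⟨a, ha⟩, p, hpq.isAttractingFixedPoint,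
      fun p' hp' => hpq.eq_of_isAttractingFixedPoint hδ hxp hxq hp'⟩
  · obtain ⟨p, q, hpq⟩ := hNS γ hγ
    obtain ⟨x, hxp, hxq⟩ := hthird hpq
    rw [hpq.eq_of_isAttractingFixedPoint hδ hxp hxq hp']
    exact h.isAttractingLine hirr hpq hxp hxq
  · refine hδ.forall_boundary (Γ := Γ) o hcocompact hpq.ne
      (h.line_le_hyperplane_repelling hirr hd hpq.inv hxq hxp)
      (h.line_le_hyperplane_repelling hirr hd hpq hxp hxq) (fun γ y hy => ?_)
      fun y z hy hlim => ?_
    · rw [h.equivariant_line, h.equivariant_hyperplane]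
      exact Submodule.map_mono hy
    · exact ConvexRep.le_of_tendsto_subspaceDist (h.holder_line.tendsto hlim)
        (h.holder_hyperplane.tendsto hlim) hy
  · rintro ⟨ξ, η⟩ h
    replace h : ConvexRep.IsConvexPair o ρ ξ η := h
    have heq : ∀ y, ξ y = ξ₀ y ∧ η y = η₀ y := by
      -- An element determines `ξ` at its attracting point and `η` at its repelling one; its inverse
      -- supplies the other two values.
      have h1 := h.eq_at_fixed_points h₀ hirr hpq hxp hxq
      have h2 := h.eq_at_fixed_points h₀ hirr hpq.inv hxq hxp
      refine hδ.forall_boundary (Γ := Γ) o hcocompact hpq.ne ⟨h1.1, h2.2⟩ ⟨h2.1, h1.2⟩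
        (fun γ y hy => ⟨?_, ?_⟩) fun y z hy hlim => ⟨?_, ?_⟩
      · refine Projectivization.submodule_injective ?_
        rw [h.equivariant_line, h₀.equivariant_line, hy.1]
      · refine Subtype.ext ?_
        rw [h.equivariant_hyperplane, h₀.equivariant_hyperplane, hy.2]
      · refine Projectivization.submodule_injective
          (ConvexRep.eq_of_tendsto_subspaceDist (h.holder_line.tendsto hlim) ?_)
        simp only [fun n => (hy n).1]
        exact h₀.holder_line.tendsto hlim
      · refine Subtype.ext
          (ConvexRep.eq_of_tendsto_subspaceDist (h.holder_hyperplane.tendsto hlim) ?_)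
        simp only [fun n => (hy n).2]
        exact h₀.holder_hyperplane.tendsto hlim
    exact Prod.ext (funext fun y => (heq y).1) (funext fun y => (heq y).2)
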